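/- **Calculus.** Let $a$ range over a countable set of channel names. Labels are $l^s$ with $l$ from a countable set of atomic labels and $s$ a finite binary string ($l=l^\epsilon$). Actions are $\alpha ::= a \mid \bar a \mid \tau \mid \omega$, where $\omega$ is a distinguished success action that is not a channel. CCS$_\sigma$ processes are $$P,Q ::= L{:}\alpha.P \mid P\,|\,Q \mid P+Q \mid L{:}\textstyle\sum_i p_iP_i \mid (\nu a)P \mid\, !P \mid 0 ,$$ with finite sums, $p_i\ge 0$, $\sum_i p_i=1$; $P+_pQ$ is the binary sum with weights $p,1-p$, $p\in[0,1]$. Schedulers are the terms $S::=\sigma(L).S\mid\sigma(L,L).S\mid\sum_iS_i\mid 0$ (finite sums), possibly of infinite length, but with only finitely many nested sums before the next $\sigma$. For a guard $\sigma(\cdot)$, the transitions of a complete process $P\parallel \sigma(\cdot).S$ are the least relation with: - ACT: $L{:}\alpha.P\parallel\sigma(L).S\xrightarrow{\alpha}\delta(P\parallel S)$; PROB: $L{:}\sum_ip_iP_i\parallel\sigma(L).S\xrightarrow{\tau}\sum_i[p_i]\,\delta(P_i\parallel S)$. - RES, SUM, PAR: a transition $P\parallel T\xrightarrow{\alpha}\mu$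 gives $(\nu a)P\parallel T\xrightarrow{\alpha}(\nu a)\mu$ if $\alpha\ne a,\bar a$; $P+Q\parallel T\xrightarrow{\alpha}\mu$; and $P\,|\,Q\parallel T\xrightarrow{\alpha}\mu\,|\,Q$; symmetrically for the right operand. - COM: if $P\parallel\sigma(L_1)\xrightarrow{\alpha}\delta(P'\parallel 0)$ and $Q\parallel\sigma(L_2)\xrightarrow{\bar\alpha}\delta(Q'\parallel 0)$ with $\alpha\in\{a,\bar a\}$, $\bar{\bar a}=a$, then $P\,|\,Q\parallel\sigma(L_1,L_2).S\xrightarrow{\tau}\delta(P'\,|\,Q'\parallel S)$. - BANG: if $P\parallel T\xrightarrow{\alpha}\mu$ then $!P\parallel T\xrightarrow{\alpha}\rho_0(\mu)\,|\,\rho_1(!P)$; and if $P\parallel\sigma(L_1)\xrightarrow{\alpha}\delta(P_1\parallel 0)$, $P\parallel\sigma(L_2)\xrightarrow{\bar\alpha}\delta(P_2\parallel 0)$ with $\alpha\in\{a,\bar a\}$, then $!P\parallel\sigma(L_1,L_2).S\xrightarrow{\tau}\delta(\rho_0(P_1)\,|\,\rho_{10}(P_2)\,|\,\rho_{11}(!P)\parallel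 S)$, where $\rho_k$ replaces every label $l^s$ by $l^{sk}$. A complete process $P\parallel\sum_iS_i$ has the transitions of $P\parallel S_i$ for the first $i$ for which $P\parallel S_i$ has any, and $P\parallel0$ has none. **Labelings.** The labeling of $P$ is *deterministic* if for every scheduler $S$ there is at most one transition $P\parallel S\xrightarrow{\alpha}\mu$, and the same holds for every process reachable from $P$ by transitions of positive probability. Two labels are *disjoint* unless they have the same atomic label and one index is a prefix of the other. The labeling of a process or context is *fresh* w.r.t. a set of processes if its labels are pairwise disjoint (for different occurrences) and disjoint from all labels of these processes. **Testing.** $(\nu)P$ is the restriction of $P$ on all its channels (not on $\omega$). $\mathit{Syn}(P)$ is the set of schedulers $S$ that are non-blocking for $P$: whenever a complete process reachable from $P\parallel S$ has no transition, its process component has no transition under any scheduler. A test w.r.t. a set of processes is a process in which $\omega$ occurs, with a deterministic labeling that is fresh w.r.t. that set. $p_\omega(P,S,O)$ is the probability of the set of executions of $(\nu)(P\,|\,O)\parallel S$ that contain $\omega$. Then $P\sqsubseteq_{\rm may}Q$ iff for all tests $O$ w.r.t. $\{P,Q\}$ and all $S_P\in \mathit{Syn}((\nu)(P|O))$ there is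 $S_Q\in \mathit{Syn}((\nu)(Q|O))$ with $p_\omega(P,S_P,O)\le p_\omega(Q,S_Q,O)$; and $P\sqsubseteq_{\rm must}Q$ iff for all such $O$ and all $S_Q\in \mathit{Syn}((\nu)(Q|O))$ there is $S_P\in \mathit{Syn}((\nu)(P|O))$ with $p_\omega(P,S_P,O)\le p_\omega(Q,S_Q,O)$. The equivalences $\approx_{\rm may}$, $\approx_{\rm must}$ are the symmetric parts of these preorders. **Theorem.** Let $P,Q$ be CCS$_\sigma$ processes with deterministic labelings, $p\in[0,1]$, $l,l_1$ labels, and let $C$ be a context (a process with one hole) in which $!$ does not occur and whose labeling is fresh w.r.t. $\{\,l_1{:}\tau.P,\ l_1{:}\tau.Q,\ l{:}(P+_pQ)\,\}$. Then $$l{:}\big(C[l_1{:}\tau.P]+_pC[l_1{:}\tau.Q]\big)\ \approx_{\rm may}\ C[l{:}(P+_pQ)]\quad\text{and}\quad l{:}\big(C[l_1{:}\tau.P]+_pC[l_1{:}\tau.Q]\big)\ \approx_{\rm must}\ C[l{:}(P+_pQ)].$$ -/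

import Mathlib

open scoped NNReal ENNReal

namespace CCS

/-- Channel names (a countable set). -/
abbrev Chan := ℕ

/-- Labels `l^s`: an atomic label `l` (from a countable set) with a finite binary index `s`. -/
structure Label where
  atom : ℕ
  idx : List Bool

/-- `(l^s)` extended by the string `k`, that is `l^{sk}`. -/
def Label.ext (L : Label) (k : List Bool) : Label := ⟨L.atom, L.idx ++ k⟩

/-- Two labels are disjoint if no label can be obtained from both of them by extending the
indexes. For labels with equally long (e.g. empty) indexes this just means that they differ. -/
def Label.Disj (L M : Label) : Prop :=
  ¬ (L.atom = M.atom ∧ (L.idx <+: M.idx ∨ M.idx <+: L.idx))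

/-- Prefixes / actions: input `a`, output `ā`, the silent action `τ`, and the distinguished
success action `ω` (which is not a channel). -/
inductive Act where
  | inp (a : Chan)
  | out (a : Chan)
  | tau
  | omega

/-- `α` and `β` are complementary visible actions `a`, `ā` (in either order). -/
def Act.Compl (α β : Act) : Prop :=
  ∃ a, (α = .inp a ∧ β = .out a) ∨ (α = .out a ∧ β = .inp a)

/-- The channel of an action, if any. -/
def Act.chan? : Act → Option Chan
  | .inp a => some a
  | .out a => some a
  | .tau => none
  | .omega => none

/-- Processes of CCS with explicit labels. In `psum l w P` (the internal probabilistic choice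
`l : ∑ i, p_i P_i`) the weights `p_i = w i` form a probability distribution on `Fin n`. -/
inductive Proc where
  | pre (l : Label) (α : Act) (P : Proc)
  | par (P Q : Proc)
  | sum (P Q : Proc)
  | psum {n : ℕ} (l : Label) (w : PMF (Fin n)) (P : Fin n → Proc)
  | res (a : Chan) (P : Proc)
  | bang (P : Proc)
  | nil

namespace Proc

/-- The binary probabilistic choice `l : (P +_p Q)`. -/
noncomputable def bsum (l : Label) (p : ℝ≥0) (hp : p ≤ 1) (P Q : Proc) : Proc :=
  .psum l
    (PMF.ofFintype ![(p : ℝ≥0∞), ((1 - p : ℝ≥0) : ℝ≥0∞)] (by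
      simp only [Fin.sum_univ_two, Matrix.cons_val_zero, Matrix.cons_val_one]
      rw [← ENNReal.coe_add, add_tsub_cancel_of_le hp, ENNReal.coe_one]))
    ![P, Q]

/-- The relabelling `ρ_k`, replacing every label `l^s` by `l^{sk}`. -/
def relabel (k : List Bool) : Proc → Proc
  | pre l α P => pre (l.ext k) α (P.relabel k)
  | par P Q => par (P.relabel k) (Q.relabel k)
  | sum P Q => sum (P.relabel k) (Q.relabel k)
  | psum l w P => psum (l.ext k) w (fun i => (P i).relabel k)
  | res a P => res a (P.relabel k)
  | bang P => bang (P.relabel k)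
  | nil => nil

/-- All occurrences of labels in a process. -/
def labels : Proc → List Label
  | pre l _ P => l :: P.labels
  | par P Q => P.labels ++ Q.labels
  | sum P Q => P.labels ++ Q.labels
  | psum l _ P => l :: (List.ofFn fun i => (P i).labels).flatten
  | res _ P => P.labels
  | bang P => P.labels
  | nil => []

/-- All occurrences of prefixes in a process. -/
def actions : Proc → List Act
  | pre _ α P => α :: P.actions
  | par P Q => P.actions ++ Q.actions
  | sum P Q => P.actions ++ Q.actions
  | psum _ _ P => (List.ofFn fun i => (P i).actions).flatten
  | res _ P => P.actions
  | bang P => P.actions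
  | nil => []

/-- The process contains no replication. -/
def BangFree : Proc → Prop
  | pre _ _ P => P.BangFree
  | par P Q => P.BangFree ∧ Q.BangFree
  | sum P Q => P.BangFree ∧ Q.BangFree
  | psum _ _ P => ∀ i, (P i).BangFree
  | res _ P => P.BangFree
  | bang _ => False
  | nil => True

/-- `(ν)P`: the restriction of `P` on all its channels. The action `ω` is not restricted. -/
def hide (P : Proc) : Proc := (P.actions.filterMap Act.chan?).foldr Proc.res P

end Proc

/-- A linear family of labels: the labels are pairwise disjoint. -/
def Linear (ls : List Label) : Prop := ls.Pairwise Label.Disj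

/-- A family of labels (the labeling of a process, test or context) is fresh with respect to a
set `Ps` of processes: it is linear and disjoint from the labels of the processes in `Ps`. -/
def FreshLabels (ls : List Label) (Ps : Set Proc) : Prop :=
  Linear ls ∧ ∀ L ∈ ls, ∀ R ∈ Ps, ∀ M ∈ R.labels, L.Disj M

/-! ### Contexts -/

/-- A context: a process with exactly one hole. In `psum l w i C P` the hole is in the
summand `i`, and `P j` is the summand `j` for `j ≠ i`. -/
inductive Ctx where
  | hole
  | pre (l : Label) (α : Act) (C : Ctx)
  | parL (C : Ctx) (R : Proc)
  | parR (R : Proc) (C : Ctx)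
  | sumL (C : Ctx) (R : Proc)
  | sumR (R : Proc) (C : Ctx)
  | psum {n : ℕ} (l : Label) (w : PMF (Fin n)) (i : Fin n) (C : Ctx)
      (P : {j : Fin n // j ≠ i} → Proc)
  | res (a : Chan) (C : Ctx)
  | bang (C : Ctx)

namespace Ctx

/-- `C[X]`. -/
def fill (X : Proc) : Ctx → Proc
  | hole => X
  | pre l α C => .pre l α (C.fill X)
  | parL C R => .par (C.fill X) R
  | parR R C => .par R (C.fill X)
  | sumL C R => .sum (C.fill X) R
  | sumR R C => .sum R (C.fill X)
  | psum l w i C P => .psum l w (fun j => if h : j = i then C.fill X else P ⟨j, h⟩)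
  | res a C => .res a (C.fill X)
  | bang C => .bang (C.fill X)

/-- The labels occurring in the context itself. -/
def labels (C : Ctx) : List Label := (C.fill .nil).labels

/-- The context contains no replication. -/
def BangFree (C : Ctx) : Prop := (C.fill .nil).BangFree

end Ctx

/-! ### Schedulers -/

/-- What a scheduler prefix selects: a single action, `σ(l)`, or a synchronization,
`σ(l₁, l₂)`. -/
inductive Guard where
  | one (l : Label)
  | two (l₁ l₂ : Label)

/-- A scheduler up to (and including) its first guards:
`0`, `σ(L).□`, `σ(L,L).□`, or a finite sum of such terms. -/
inductive SchedHead where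
  | nil
  | pre (g : Guard)
  | choice {n : ℕ} (h : Fin n → SchedHead)

/-- The occurrences of guards (equivalently, of continuations `□`) in a head. -/
def SchedHead.Pos : SchedHead → Type
  | .nil => Empty
  | .pre _ => Unit
  | .choice h => Σ i, (h i).Pos

/-- One layer of scheduler syntax. -/
abbrev SchedF : PFunctor.{0, 0} := ⟨SchedHead, SchedHead.Pos⟩

/-- Schedulers `S ::= σ(L).S | σ(L,L).S | ∑ i, S i | 0` of possibly infinite length (as needed
for processes with infinite executions): the possibly infinite terms over this grammar in which
infinitely many guards are met on every infinite branch. -/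
abbrev Sched := SchedF.M

/-! ### Operational semantics -/

/-- `Step P g α μ` means that `P ∥ g.S` makes, by the rules for processes, an `α`-transition to
the distribution of `P' ∥ S`, with `P'` distributed as `μ`. (No rule inspects or changes the
continuation `S` of the scheduler.) -/
inductive Step : Proc → Guard → Act → PMF Proc → Prop
  | act (l : Label) (α : Act) (P : Proc) :
      Step (.pre l α P) (.one l) α (PMF.pure P)
  | res {P : Proc} {g : Guard} {α : Act} {μ : PMF Proc} {a : Chan} :
      Step P g α μ → α ≠ .inp a → α ≠ .out a →
      Step (.res a P) g α (μ.map (Proc.res a))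
  | sum1 {P Q : Proc} {g : Guard} {α : Act} {μ : PMF Proc} :
      Step P g α μ → Step (.sum P Q) g α μ
  | sum2 {P Q : Proc} {g : Guard} {α : Act} {μ : PMF Proc} :
      Step Q g α μ → Step (.sum P Q) g α μ
  | par1 {P Q : Proc} {g : Guard} {α : Act} {μ : PMF Proc} :
      Step P g α μ → Step (.par P Q) g α (μ.map fun P' => .par P' Q)
  | par2 {P Q : Proc} {g : Guard} {α : Act} {μ : PMF Proc} :
      Step Q g α μ → Step (.par P Q) g α (μ.map fun Q' => .par P Q')
  | com {P Q P' Q' : Proc} {l₁ l₂ : Label} {α β : Act} :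
      Step P (.one l₁) α (PMF.pure P') → Step Q (.one l₂) β (PMF.pure Q') → α.Compl β →
      Step (.par P Q) (.two l₁ l₂) .tau (PMF.pure (.par P' Q'))
  | prob {n : ℕ} (l : Label) (w : PMF (Fin n)) (P : Fin n → Proc) :
      Step (.psum l w P) (.one l) .tau (w.map P)
  | bang1 {P : Proc} {g : Guard} {α : Act} {μ : PMF Proc} :
      Step P g α μ →
      Step (.bang P) g α
        (μ.map fun P' => .par (P'.relabel [false]) ((Proc.bang P).relabel [true]))
  | bang2 {P P₁ P₂ : Proc} {l₁ l₂ : Label} {α β : Act} :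
      Step P (.one l₁) α (PMF.pure P₁) → Step P (.one l₂) β (PMF.pure P₂) → α.Compl β →
      Step (.bang P) (.two l₁ l₂) .tau
        (PMF.pure (.par (.par (P₁.relabel [false]) (P₂.relabel [true, false]))
          ((Proc.bang P).relabel [true, true])))

/-- `Fires P h q α μ`: with a scheduler whose head is `h`, the process `P` makes an
`α`-transition to `μ`, and the scheduler continues at its guard `q`. In a scheduler choice the
first summand that allows the process to make a transition is used. -/
def Fires (P : Proc) : (h : SchedHead) → h.Pos → Act → PMF Proc → Prop
  | .nil, _, _, _ => False
  | .pre g, _, α, μ => Step P g α μ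
  | .choice h, ⟨i, q⟩, α, μ =>
      Fires P (h i) q α μ ∧ ∀ j < i, ∀ q' β ν, ¬ Fires P (h j) q' β ν

/-- Complete processes `P ∥ S`. -/
abbrev State := Proc × Sched

/-- The transition relation of complete processes. -/
def CStep (s : State) (α : Act) (m : PMF State) : Prop :=
  ∃ (q : s.2.head.Pos) (μ : PMF Proc),
    Fires s.1 s.2.head q α μ ∧ m = μ.map fun P' => (P', s.2.children q)

/-- `Reach s t`: the state `t` is reachable from `s` by transitions of positive probability. -/
inductive Reach (s : State) : State → Prop
  | refl : Reach s s
  | step {t u : State} {α : Act} {m : PMF State} :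
      Reach s t → CStep t α m → m u ≠ 0 → Reach s u

/-- `P'` is reachable from `P` by transitions of positive probability, under arbitrary
schedulers that may be changed at every step. -/
inductive PReach (P : Proc) : Proc → Prop
  | refl : PReach P P
  | step {P' P'' : Proc} {S S' : Sched} {α : Act} {m : PMF State} :
      PReach P P' → CStep (P', S) α m → m (P'', S') ≠ 0 → PReach P P''

/-- The labeling of `P` is deterministic: for every scheduler there is at most one transition
from `P`, and the same holds for all processes that can be reached from `P`. -/
def Deterministic (P : Proc) : Prop :=
  ∀ P', PReach P P' → ∀ (S : Sched) (α β : Act) (m m' : PMF State),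
    CStep (P', S) α m → CStep (P', S) β m' → α = β ∧ m = m'

/-- No scheduler allows `P` to make a transition. -/
def Blocked (P : Proc) : Prop := ∀ (S : Sched) (α : Act) (m : PMF State), ¬ CStep (P, S) α m

/-- `Syn P`: the schedulers that are non-blocking for `P`, i.e. that always schedule some
transition, except when the process itself is blocked. -/
def Syn (P : Proc) : Set Sched :=
  {S | ∀ t : State, Reach (P, S) t → (∃ α m, CStep t α m) ∨ Blocked t.1}

/-! ### Testing -/

/-- The probability that the automaton moves from `s` to `t` by the action `α`. (In a fully
probabilistic automaton the supremum is over at most one transition.) -/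
noncomputable def stepProb (s : State) (α : Act) (t : State) : ℝ≥0∞ :=
  ⨆ (m : PMF State) (_ : CStep s α m), m t

/-- The probability of the cone of the finite execution `s a₁ s₁ a₂ s₂ ⋯ aₙ sₙ`. -/
noncomputable def coneProb : State → List (Act × State) → ℝ≥0∞
  | _, [] => 1
  | s, (α, t) :: e => stepProb s α t * coneProb t e

/-- The last action of the finite execution is `ω`, and it is the first occurrence of `ω`. -/
def EndsAtFirstOmega (e : List (Act × State)) : Prop :=
  ∃ e' t, e = e' ++ [(Act.omega, t)] ∧ ∀ x ∈ e', x.1 ≠ Act.omega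

/-- `p_ω(P, S, O)`: the probability of the set of executions of `(ν)(P | O) ∥ S` that contain
`ω`, which is the disjoint union of the cones of the finite executions that end at their first
`ω`. -/
noncomputable def pOmega (P : Proc) (S : Sched) (O : Proc) : ℝ≥0∞ :=
  ∑' e : {e : List (Act × State) // EndsAtFirstOmega e},
    coneProb ((Proc.par P O).hide, S) e.1

/-- `O` is a test with respect to the set `Ps`: a process with a deterministic labeling that is
fresh with respect to `Ps`, containing the action `ω`. -/
def IsTest (Ps : Set Proc) (O : Proc) : Prop :=
  Deterministic O ∧ FreshLabels O.labels Ps ∧ Act.omega ∈ O.actions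

/-- The may-testing preorder. -/
def MayLE (P Q : Proc) : Prop :=
  ∀ O, IsTest {P, Q} O →
    ∀ S ∈ Syn (Proc.par P O).hide, ∃ T ∈ Syn (Proc.par Q O).hide,
      pOmega P S O ≤ pOmega Q T O

/-- The must-testing preorder. -/
def MustLE (P Q : Proc) : Prop :=
  ∀ O, IsTest {P, Q} O →
    ∀ T ∈ Syn (Proc.par Q O).hide, ∃ S ∈ Syn (Proc.par P O).hide,
      pOmega P S O ≤ pOmega Q T O

/-- May-testing equivalence. -/
def MayEquiv (P Q : Proc) : Prop := MayLE P Q ∧ MayLE Q P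

/-- Must-testing equivalence. -/
def MustEquiv (P Q : Proc) : Prop := MustLE P Q ∧ MustLE Q P

end CCS

/-!
A context in which `!` does not occur reaches its hole at most once, so a choice in the hole can
be moved to the front of the whole process. Suppose that the choice `l` of the outer process
stands beside a test `O`. Before `σ(l)` fires, only `O` can move, hence a scheduler acts in the
same way on the processes `C[l₁:τ.Pᵢ]` that the choice leads to, provided that `σ(l)` is skipped;
conversely, a scheduler for these processes can always be preceded by `σ(l)`. It remains to
compare the mixture of the `C[l₁:τ.Pᵢ]` with `C[l:∑ wᵢ Pᵢ]`. Exchanging `l₁` and `l` in a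
scheduler until the hole fires makes both sides perform the same steps up to that point, and
there both sides become the same mixture of processes with the `Pᵢ` in the hole.

The probability of `ω` is the supremum over `n` of the probability of reaching `ω` within `n`
steps, which is why the additional step `σ(l)` at the front does not matter.
-/

namespace CCS

/-! ### Schedulers as lists of leaves -/

/-- The guards occurring in a head, from left to right, each with the value that `k` assigns to
its occurrence. -/
def SchedHead.leaves {X : Type} : (h : SchedHead) → (h.Pos → X) → List (Guard × X)
  | .nil, _ => []
  | .pre g, k => [(g, k ())]
  | .choice (n := n) h, k =>
      (List.finRange n).flatMap fun i => (h i).leaves fun q => k ⟨i, q⟩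

/-- The first guards of a scheduler, from left to right, with their continuations. -/
def Sched.leaves (S : Sched) : List (Guard × Sched) := S.head.leaves S.children

/-- The process can make a transition by the guard `g`. -/
def Proc.Enabled (P : Proc) (g : Guard) : Prop := ∃ α μ, Step P g α μ

section FirstEnabled

variable {X : Type} {P : Proc} {g : Guard} {x : X} {L : List (Guard × X)}

open Classical in
/-- The first leaf whose guard is enabled in `P`: the one that a scheduler with the leaves `L`
uses. -/
noncomputable def Proc.firstEnabled (P : Proc) (L : List (Guard × X)) : Option (Guard × X) :=
  L.find? fun y => P.Enabled y.1

theorem Proc.firstEnabled_cons_of_enabled {y : Guard × X} (h : P.Enabled y.1) :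
    P.firstEnabled (y :: L) = some y := by
  simp [Proc.firstEnabled, h]

theorem Proc.firstEnabled_cons_of_not_enabled {y : Guard × X} (h : ¬ P.Enabled y.1) :
    P.firstEnabled (y :: L) = P.firstEnabled L := by
  simp [Proc.firstEnabled, h]

theorem Proc.firstEnabled_congr {Q : Proc} (h : P.Enabled = Q.Enabled) (L : List (Guard × X)) :
    P.firstEnabled L = Q.firstEnabled L := by
  rw [Proc.firstEnabled, Proc.firstEnabled, h]

theorem Proc.enabled_of_firstEnabled (h : P.firstEnabled L = some (g, x)) : P.Enabled g := by
  classical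
  exact of_decide_eq_true (List.find?_some (p := fun y : Guard × X => decide (P.Enabled y.1)) h)

theorem Proc.firstEnabled_ne_none_iff : P.firstEnabled L ≠ none ↔
    ∃ g x α μ, P.firstEnabled L = some (g, x) ∧ Step P g α μ := by
  constructor
  · intro h
    obtain ⟨⟨g, x⟩, hg⟩ := Option.ne_none_iff_exists'.1 h
    obtain ⟨α, μ, hs⟩ := Proc.enabled_of_firstEnabled hg
    exact ⟨g, x, α, μ, hg, hs⟩
  · rintro ⟨g, x, -, -, h, -⟩
    simp [h]

theorem findSome?_finRange_eq_some_iff {β : Type*} {n : ℕ} {f : Fin n → Option β} {b : β} :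
    (List.finRange n).findSome? f = some b ↔ ∃ i, f i = some b ∧ ∀ j < i, f j = none := by
  induction n with
  | zero => simp
  | succ n ih =>
    rw [List.finRange_succ, List.findSome?_cons, Fin.exists_fin_succ]
    cases h0 : f 0 with
    | some c => simp [Fin.forall_fin_succ, h0]
    | none => simp [Fin.forall_fin_succ, h0, List.findSome?_map, ih]

theorem firstEnabled_choice_eq_some_iff {n : ℕ} {h : Fin n → SchedHead}
    {k : (SchedHead.choice h).Pos → X} {y : Guard × X} :
    P.firstEnabled ((SchedHead.choice h).leaves k) = some y ↔
      ∃ i, P.firstEnabled ((h i).leaves fun q => k ⟨i, q⟩) = some y ∧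
        ∀ j < i, P.firstEnabled ((h j).leaves fun q => k ⟨j, q⟩) = none := by
  classical
  rw [← findSome?_finRange_eq_some_iff]
  simp only [Proc.firstEnabled, SchedHead.leaves, List.find?_flatMap]

theorem exists_fires_iff {α : Act} {μ : PMF Proc} (h : SchedHead) (k : h.Pos → X) (x : X) :
    (∃ q, Fires P h q α μ ∧ k q = x) ↔
      ∃ g, P.firstEnabled (h.leaves k) = some (g, x) ∧ Step P g α μ := by
  induction h generalizing α μ x with
  | nil => simp [SchedHead.leaves, Proc.firstEnabled, Fires]
  | pre g =>
    constructor
    · rintro ⟨q, hs, rfl⟩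
      exact ⟨g, Proc.firstEnabled_cons_of_enabled ⟨α, μ, hs⟩, hs⟩
    · rintro ⟨g', hg, hs⟩
      obtain ⟨rfl, rfl⟩ := Prod.mk.inj (List.mem_singleton.1 (List.mem_of_find?_eq_some hg))
      exact ⟨(), hs, rfl⟩
  | choice h ih =>
    have not_fires_iff (j) : (∀ q β ν, ¬ Fires P (h j) q β ν) ↔
        P.firstEnabled ((h j).leaves fun q => k ⟨j, q⟩) = none := by
      rw [← not_iff_not, ← ne_eq (P.firstEnabled _), Proc.firstEnabled_ne_none_iff]
      push Not
      constructor
      · rintro ⟨q, β, ν, hq⟩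
        obtain ⟨g, hg, hs⟩ := (ih j (fun q => k ⟨j, q⟩) _).1 ⟨q, hq, rfl⟩
        exact ⟨g, _, β, ν, hg, hs⟩
      · rintro ⟨g, y, β, ν, hg, hs⟩
        obtain ⟨q, hq, -⟩ := (ih j (fun q => k ⟨j, q⟩) y).2 ⟨g, hg, hs⟩
        exact ⟨q, β, ν, hq⟩
    simp only [firstEnabled_choice_eq_some_iff, ← not_fires_iff]
    constructor
    · rintro ⟨⟨i, q⟩, ⟨hf, hj⟩, rfl⟩
      obtain ⟨g, hg, hs⟩ := (ih i (fun q => k ⟨i, q⟩) _).1 ⟨q, hf, rfl⟩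
      exact ⟨g, ⟨i, hg, hj⟩, hs⟩
    · rintro ⟨g, ⟨i, hg, hj⟩, hs⟩
      obtain ⟨q, hq, hk⟩ := (ih i (fun q => k ⟨i, q⟩) _).2 ⟨g, hg, hs⟩
      exact ⟨⟨i, q⟩, ⟨hq, hj⟩, hk⟩

end FirstEnabled

theorem cstep_iff {P : Proc} {S : Sched} {α : Act} {m : PMF State} :
    CStep (P, S) α m ↔ ∃ g T μ, P.firstEnabled S.leaves = some (g, T) ∧ Step P g α μ ∧
      m = μ.map fun P' => (P', T) := by
  constructor
  · rintro ⟨q, μ, hf, rfl⟩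
    obtain ⟨g, hg, hs⟩ := (exists_fires_iff S.head S.children _).1 ⟨q, hf, rfl⟩
    exact ⟨g, _, μ, hg, hs, rfl⟩
  · rintro ⟨g, T, μ, hg, hs, rfl⟩
    obtain ⟨q, hf, rfl⟩ := (exists_fires_iff S.head S.children T).2 ⟨g, hg, hs⟩
    exact ⟨q, μ, hf, rfl⟩

theorem exists_cstep_iff {P : Proc} {S : Sched} :
    (∃ α m, CStep (P, S) α m) ↔ P.firstEnabled S.leaves ≠ none := by
  simp only [cstep_iff, Proc.firstEnabled_ne_none_iff]
  constructor
  · rintro ⟨α, m, g, T, μ, hg, hs, -⟩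
    exact ⟨g, T, α, μ, hg, hs⟩
  · rintro ⟨g, T, α, μ, hg, hs⟩
    exact ⟨α, _, g, T, μ, hg, hs, rfl⟩

theorem cstep_congr {P : Proc} {S T : Sched}
    (h : P.firstEnabled S.leaves = P.firstEnabled T.leaves) (α : Act) (m : PMF State) :
    CStep (P, S) α m ↔ CStep (P, T) α m := by
  rw [cstep_iff, cstep_iff, h]

/-- The layer of scheduler syntax that offers the leaves in the list `L`. -/
def SchedF.ofList {X : Type} (L : List (Guard × X)) : SchedF X :=
  ⟨.choice fun i : Fin L.length => .pre (L.get i).1, fun q => (L.get q.1).2⟩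

theorem leaves_ofList {X Y : Type} (L : List (Guard × X)) (f : X → Y) :
    ((SchedF.ofList L).1.leaves fun q => f ((SchedF.ofList L).2 q)) =
      L.map (Prod.map id f) := by
  simp only [SchedF.ofList, SchedHead.leaves]
  conv_rhs => rw [← List.map_get_finRange L, List.map_map, List.map_eq_flatMap]
  rfl

/-- The coalgebra behind `Sched.unfold`. -/
def Sched.unfoldLayer {X : Type} (leaves : X → List (Guard × (X ⊕ Sched))) :
    X ⊕ Sched → SchedF (X ⊕ Sched)
  | .inl x => SchedF.ofList (leaves x)
  | .inr S => SchedF.map Sum.inr S.dest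

/-- The scheduler whose first leaves at the seed `x` are `leaves x`. A leaf continues either
with another seed or with a given scheduler. -/
def Sched.unfold {X : Type} (leaves : X → List (Guard × (X ⊕ Sched))) (x : X) : Sched :=
  PFunctor.M.corec (Sched.unfoldLayer leaves) (.inl x)

theorem corec_unfoldLayer_inr {X : Type} (leaves : X → List (Guard × (X ⊕ Sched))) (S : Sched) :
    PFunctor.M.corec (Sched.unfoldLayer leaves) (.inr S) = S := by
  refine PFunctor.M.bisim
    (fun A B => A = PFunctor.M.corec (Sched.unfoldLayer leaves) (.inr B)) ?_ _ _ rfl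
  rintro _ B rfl
  rw [PFunctor.M.dest_corec]
  exact ⟨B.head, fun q => PFunctor.M.corec (Sched.unfoldLayer leaves) (.inr (B.children q)),
    B.children, rfl, rfl, fun _ => rfl⟩

theorem leaves_eq_of_dest_eq {S : Sched} {Z : SchedF Sched} (h : S.dest = Z) :
    S.leaves = Z.1.leaves Z.2 := by
  subst h
  rfl

theorem leaves_unfold {X : Type} (leaves : X → List (Guard × (X ⊕ Sched))) (x : X) :
    (Sched.unfold leaves x).leaves =
      (leaves x).map (Prod.map id (Sum.elim (Sched.unfold leaves) id)) := by
  have corec_eq : PFunctor.M.corec (Sched.unfoldLayer leaves) =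
      Sum.elim (Sched.unfold leaves) id := by
    funext y
    rcases y with x | S
    · rfl
    · exact corec_unfoldLayer_inr leaves S
  rw [Sched.unfold, leaves_eq_of_dest_eq (PFunctor.M.dest_corec _ _), ← corec_eq]
  exact leaves_ofList (leaves x) (PFunctor.M.corec (Sched.unfoldLayer leaves))

/-- The scheduler `∑ i, g i.T i` with the leaves `(g i, T i)` in the list `L`. -/
def Sched.ofLeaves (L : List (Guard × Sched)) : Sched :=
  Sched.unfold (X := Unit) (fun _ => L.map (Prod.map id .inr)) ()

@[simp]
theorem leaves_ofLeaves (L : List (Guard × Sched)) : (Sched.ofLeaves L).leaves = L := by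
  rw [Sched.ofLeaves, leaves_unfold, List.map_map, Prod.map_comp_map]
  simp

/-- The scheduler `σ(g).T`. -/
def Sched.guard (g : Guard) (T : Sched) : Sched := .ofLeaves [(g, T)]

theorem Proc.Enabled.firstEnabled_guard {P : Proc} {g : Guard} (h : P.Enabled g) (T : Sched) :
    P.firstEnabled (Sched.guard g T).leaves = some (g, T) := by
  rw [Sched.guard, leaves_ofLeaves]
  exact Proc.firstEnabled_cons_of_enabled h

theorem Step.cstep_guard {P : Proc} {g : Guard} {α : Act} {μ : PMF Proc} (h : Step P g α μ)
    (T : Sched) : CStep (P, Sched.guard g T) α (μ.map fun P' => (P', T)) :=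
  cstep_iff.2 ⟨g, T, μ, Proc.Enabled.firstEnabled_guard ⟨α, μ, h⟩ T, h, rfl⟩

/-! ### The probability of `ω` within a number of steps -/

/-- The expectation of `φ` under `μ`. -/
noncomputable def expect {α : Type*} (μ : PMF α) (φ : α → ℝ≥0∞) : ℝ≥0∞ := ∑' a, μ a * φ a

section Expect

variable {α β : Type*} (μ : PMF α) {φ ψ : α → ℝ≥0∞}

theorem expect_bind (κ : α → PMF β) (φ : β → ℝ≥0∞) :
    expect (μ.bind κ) φ = expect μ fun a => expect (κ a) φ := by
  simp only [expect, PMF.bind_apply, ← ENNReal.tsum_mul_right, ← ENNReal.tsum_mul_left]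
  rw [ENNReal.tsum_comm]
  simp only [mul_assoc]

theorem expect_pure (a : α) (φ : α → ℝ≥0∞) : expect (PMF.pure a) φ = φ a := by
  rw [expect, tsum_eq_single a fun b hb => by simp [hb]]
  simp

theorem expect_map (f : α → β) (φ : β → ℝ≥0∞) :
    expect (μ.map f) φ = expect μ fun a => φ (f a) := by
  simp only [← PMF.bind_pure_comp, expect_bind, Function.comp_apply, expect_pure]

theorem expect_const (c : ℝ≥0∞) : expect μ (fun _ => c) = c := by
  rw [expect, ENNReal.tsum_mul_right, PMF.tsum_coe, one_mul]

theorem expect_mono (h : ∀ a ∈ μ.support, φ a ≤ ψ a) : expect μ φ ≤ expect μ ψ := by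
  refine ENNReal.tsum_le_tsum fun a => ?_
  by_cases ha : μ a = 0
  · simp [ha]
  · exact mul_le_mul_right (h a ((PMF.mem_support_iff μ a).2 ha)) _

theorem expect_congr (h : ∀ a ∈ μ.support, φ a = ψ a) : expect μ φ = expect μ ψ :=
  le_antisymm (expect_mono μ fun a ha => (h a ha).le) (expect_mono μ fun a ha => (h a ha).ge)

theorem expect_comm (ν : PMF β) (φ : α → β → ℝ≥0∞) :
    (expect μ fun a => expect ν fun b => φ a b) = expect ν fun b => expect μ fun a => φ a b := by
  simp only [expect, ← ENNReal.tsum_mul_left]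
  rw [ENNReal.tsum_comm]
  simp only [mul_left_comm]

theorem map_apply_of_injective {f : α → β} (hf : f.Injective) (a : α) :
    μ.map f (f a) = μ a := by
  rw [PMF.map_apply, tsum_eq_single a fun b hb => if_neg fun h => hb (hf h.symm), if_pos rfl]

end Expect

open Classical in
/-- The probability that `ω` occurs within the first `n` steps from `s`. -/
noncomputable def omegaWithin : ℕ → State → ℝ≥0∞
  | 0, _ => 0
  | n + 1, s =>
    ∑' x : Act × State, stepProb s x.1 x.2 * if x.1 = .omega then 1 else omegaWithin n x.2

theorem omegaWithin_mono (s : State) : Monotone fun n => omegaWithin n s := by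
  classical
  refine monotone_nat_of_le_succ fun n => ?_
  induction n generalizing s with
  | zero => simp [omegaWithin]
  | succ n ih =>
    rw [omegaWithin, omegaWithin]
    refine ENNReal.tsum_le_tsum fun x => ?_
    gcongr
    split_ifs
    · exact le_rfl
    · exact ih _

theorem not_endsAtFirstOmega_nil : ¬ EndsAtFirstOmega [] := by
  rintro ⟨e', t, h, -⟩
  simp at h

theorem endsAtFirstOmega_cons {x : Act × State} {e : List (Act × State)} :
    EndsAtFirstOmega (x :: e) ↔
      (x.1 = .omega ∧ e = []) ∨ (x.1 ≠ .omega ∧ EndsAtFirstOmega e) := by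
  constructor
  · rintro ⟨_ | ⟨y, e'⟩, t, h, hne⟩
    · obtain ⟨rfl, rfl⟩ := List.cons.inj h
      exact .inl ⟨rfl, rfl⟩
    · obtain ⟨rfl, rfl⟩ := List.cons.inj h
      exact .inr ⟨hne x (by simp), e', t, rfl, fun z hz => hne z (by simp [hz])⟩
  · rintro (⟨hx, rfl⟩ | ⟨hx, e', t, rfl, hne⟩)
    · exact ⟨[], x.2, by rw [← hx]; rfl, by simp⟩
    · exact ⟨x :: e', t, rfl, List.forall_mem_cons.2 ⟨hx, hne⟩⟩

theorem tsum_list_of_nil {α : Type*} (f : List α → ℝ≥0∞) (h : f [] = 0) :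
    ∑' e, f e = ∑' x, ∑' e, f (x :: e) := by
  rw [← ENNReal.tsum_prod (f := fun x e => f (x :: e))]
  refine (Function.Injective.tsum_eq (g := fun y : α × List α => y.1 :: y.2) ?_ ?_).symm
  · rintro ⟨a, b⟩ ⟨c, d⟩ h
    simpa using h
  · rintro (_ | ⟨x, e⟩) he
    · exact absurd h he
    · exact ⟨(x, e), rfl⟩

open Classical in
theorem tsum_coneProb_length_le (n : ℕ) (s : State) :
    (∑' e : List (Act × State),
      if EndsAtFirstOmega e ∧ e.length ≤ n then coneProb s e else 0) = omegaWithin n s := by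
  induction n generalizing s with
  | zero =>
    rw [omegaWithin, ENNReal.tsum_eq_zero]
    rintro (_ | ⟨x, e⟩) <;> simp [not_endsAtFirstOmega_nil]
  | succ n ih =>
    rw [tsum_list_of_nil _ (by simp [not_endsAtFirstOmega_nil]), omegaWithin]
    congr 1
    funext x
    by_cases hx : x.1 = .omega
    · rw [tsum_eq_single [] fun e he => by simp [endsAtFirstOmega_cons, hx, he]]
      simp [endsAtFirstOmega_cons, hx, coneProb]
    · rw [if_neg hx, ← ih, ← ENNReal.tsum_mul_left]
      simp [endsAtFirstOmega_cons, hx, coneProb]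

theorem pOmega_eq_iSup_omegaWithin (P : Proc) (S : Sched) (O : Proc) :
    pOmega P S O = ⨆ n, omegaWithin n ((Proc.par P O).hide, S) := by
  classical
  simp only [← tsum_coneProb_length_le]
  refine (tsum_subtype {e | EndsAtFirstOmega e} (coneProb _)).trans ?_
  refine le_antisymm ?_ (iSup_le fun n => ENNReal.tsum_le_tsum fun e => ?_)
  · rw [ENNReal.tsum_eq_iSup_sum]
    refine iSup_le fun F => ?_
    refine le_iSup_of_le (F.sup List.length) ?_
    refine le_trans (Finset.sum_le_sum fun e he => ?_) (ENNReal.sum_le_tsum F)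
    have length_le : e.length ≤ F.sup List.length := Finset.le_sup (f := List.length) he
    simp [Set.indicator_apply, length_le]
  · by_cases he : EndsAtFirstOmega e <;> simp only [he, true_and, false_and, if_false,
      Set.indicator_apply, Set.mem_ofPred_eq, zero_le]
    split_ifs <;> simp

theorem omegaWithin_congr {P : Proc} {S T : Sched}
    (h : P.firstEnabled S.leaves = P.firstEnabled T.leaves) (n : ℕ) :
    omegaWithin n (P, S) = omegaWithin n (P, T) := by
  cases n with
  | zero => rfl
  | succ n => simp only [omegaWithin, stepProb, cstep_congr h]

theorem omegaWithin_of_firstEnabled_eq_none {P : Proc} {S : Sched}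
    (h : P.firstEnabled S.leaves = none) (n : ℕ) : omegaWithin n (P, S) = 0 := by
  cases n with
  | zero => rfl
  | succ n =>
    have no_step : ∀ α m, ¬ CStep (P, S) α m := fun α m hs =>
      exists_cstep_iff.1 ⟨α, m, hs⟩ h
    simp [omegaWithin, stepProb, no_step]

/-- `P` has at most one transition by the guard `g`. -/
def UniqueStep (P : Proc) (g : Guard) : Prop :=
  ∀ α β μ ν, Step P g α μ → Step P g β ν → α = β ∧ μ = ν

section UniqueStep

variable {P : Proc} {S T : Sched} {g : Guard} {α : Act} {μ : PMF Proc}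

theorem UniqueStep.cstep_iff (hu : UniqueStep P g) (hp : P.firstEnabled S.leaves = some (g, T))
    (hs : Step P g α μ) (β : Act) (m : PMF State) :
    CStep (P, S) β m ↔ β = α ∧ m = μ.map fun P' => (P', T) := by
  rw [CCS.cstep_iff]
  constructor
  · rintro ⟨g', T', ν, hp', hs', rfl⟩
    obtain ⟨rfl, rfl⟩ := Prod.mk.inj (Option.some.inj (hp.symm.trans hp'))
    obtain ⟨rfl, rfl⟩ := hu _ _ _ _ hs hs'
    exact ⟨rfl, rfl⟩
  · rintro ⟨rfl, rfl⟩
    exact ⟨g, T, μ, hp, hs, rfl⟩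

open Classical in
theorem UniqueStep.omegaWithin_succ (hu : UniqueStep P g)
    (hp : P.firstEnabled S.leaves = some (g, T)) (hs : Step P g α μ) (n : ℕ) :
    omegaWithin (n + 1) (P, S) =
      if α = .omega then 1 else expect μ fun P' => omegaWithin n (P', T) := by
  have stepProb_eq (β t) : stepProb (P, S) β t =
      if β = α then μ.map (fun P' => (P', T)) t else 0 := by
    simp only [stepProb, hu.cstep_iff hp hs]
    split_ifs with h <;> simp [h]
  rw [omegaWithin, ENNReal.tsum_prod', tsum_eq_single α fun β hβ => by simp [stepProb_eq, hβ]]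
  simp only [stepProb_eq, if_true]
  split_ifs
  · simp only [mul_one]
    exact PMF.tsum_coe _
  · exact expect_map μ (fun P' => (P', T)) (omegaWithin n)

end UniqueStep

section Embedding

variable {X : Type*} {e e' : X → State}

theorem stepProb_le_of_embedding (he : e.Injective) (he' : e'.Injective)
    (hstep : ∀ x α m, CStep (e x) α m → ∃ m₀ : PMF X, m = m₀.map e ∧ CStep (e' x) α (m₀.map e'))
    (α : Act) (x y : X) : stepProb (e x) α (e y) ≤ stepProb (e' x) α (e' y) := by
  refine iSup₂_le fun m hm => ?_
  obtain ⟨m₀, rfl, hm'⟩ := hstep x α m hm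
  refine le_iSup₂_of_le _ hm' ?_
  rw [map_apply_of_injective m₀ he, map_apply_of_injective m₀ he']

theorem omegaWithin_le_of_embedding (he : e.Injective) (he' : e'.Injective)
    (hstep : ∀ x α m, CStep (e x) α m → ∃ m₀ : PMF X, m = m₀.map e ∧ CStep (e' x) α (m₀.map e'))
    (n : ℕ) (x : X) : omegaWithin n (e x) ≤ omegaWithin n (e' x) := by
  classical
  induction n generalizing x with
  | zero => exact le_rfl
  | succ n ih =>
    have injective_id_map {f : X → State} (hf : f.Injective) :
        (Prod.map (id : Act → Act) f).Injective := Function.injective_id.prodMap hf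
    rw [omegaWithin, omegaWithin, ← (injective_id_map he).tsum_eq]
    · refine le_trans (ENNReal.tsum_le_tsum fun y => mul_le_mul' ?_ ?_)
        (ENNReal.tsum_comp_le_tsum_of_injective (injective_id_map he') _)
      · exact stepProb_le_of_embedding he he' hstep _ _ _
      · simp only [Prod.map_fst, Prod.map_snd, id]
        split_ifs
        · exact le_rfl
        · exact ih _
    · rintro ⟨α, t⟩ hx
      have stepProb_ne_zero : stepProb (e x) α t ≠ 0 := left_ne_zero_of_mul hx
      simp only [stepProb, ne_eq, ENNReal.iSup_eq_zero, not_forall] at stepProb_ne_zero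
      obtain ⟨m, hm, hmt⟩ := stepProb_ne_zero
      obtain ⟨m₀, rfl, -⟩ := hstep x α m hm
      obtain ⟨y, -, rfl⟩ :=
        (PMF.mem_support_map_iff _ _ _).1 ((PMF.mem_support_iff _ _).2 hmt)
      exact ⟨(α, y), rfl⟩

end Embedding

/-! ### Non-blocking schedulers -/

theorem Reach.head {s t u : State} {α : Act} {m : PMF State} (h : CStep s α m) (ht : m t ≠ 0)
    (hu : Reach t u) : Reach s u := by
  induction hu with
  | refl => exact .step .refl h ht
  | step _ h2 hm ih => exact .step ih h2 hm

theorem blocked_iff {P : Proc} : Blocked P ↔ ∀ g, ¬ P.Enabled g := by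
  constructor
  · rintro h g ⟨α, μ, hs⟩
    exact h _ α _ (hs.cstep_guard (.ofLeaves []))
  · intro h S α m hs
    obtain ⟨g, T, μ, -, hs, -⟩ := cstep_iff.1 hs
    exact h g ⟨_, _, hs⟩

section Syn

variable {P : Proc} {S : Sched}

theorem firstEnabled_ne_none_or_of_mem_syn (h : S ∈ Syn P) :
    P.firstEnabled S.leaves ≠ none ∨ ∀ g, ¬ P.Enabled g := by
  rw [← exists_cstep_iff, ← blocked_iff]
  exact h _ .refl

theorem mem_syn_of_step {P' : Proc} {T : Sched} {g : Guard} {α : Act} {μ : PMF Proc}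
    (h : S ∈ Syn P) (hp : P.firstEnabled S.leaves = some (g, T)) (hs : Step P g α μ)
    (hP' : P' ∈ μ.support) : T ∈ Syn P' := by
  refine fun t ht => h t (Reach.head (cstep_iff.2 ⟨g, T, μ, hp, hs, rfl⟩) ?_ ht)
  exact (PMF.mem_support_iff _ _).1 ((PMF.mem_support_map_iff _ _ _).2 ⟨P', hP', rfl⟩)

theorem mem_syn_of_invariant (I : Proc → Sched → Prop)
    (hlocal : ∀ P S, I P S → P.firstEnabled S.leaves ≠ none ∨ ∀ g, ¬ P.Enabled g)
    (hstep : ∀ P S, I P S → ∀ g T α μ, P.firstEnabled S.leaves = some (g, T) → Step P g α μ →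
      ∀ P' ∈ μ.support, I P' T ∨ T ∈ Syn P') (h : I P S) : S ∈ Syn P := by
  intro t ht
  have invariant : I t.1 t.2 ∨ t.2 ∈ Syn t.1 := by
    induction ht with
    | refl => exact .inl h
    | step _ hst hm ih =>
      obtain ⟨g, T, μ, hp, hs, rfl⟩ := cstep_iff.1 hst
      obtain ⟨P', hP', rfl⟩ :=
        (PMF.mem_support_map_iff _ _ _).1 ((PMF.mem_support_iff _ _).2 hm)
      rcases ih with hI | hS
      · exact hstep _ _ hI g T _ μ hp hs P' hP'
      · exact .inr (mem_syn_of_step hS hp hs hP')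
  rcases invariant with hI | hS
  · rw [show t = (t.1, t.2) from rfl, exists_cstep_iff, blocked_iff]
    exact hlocal _ _ hI
  · exact hS _ .refl

theorem mem_syn_congr {T : Sched} (h : P.firstEnabled S.leaves = P.firstEnabled T.leaves)
    (hS : S ∈ Syn P) : T ∈ Syn P := by
  refine mem_syn_of_invariant (fun Q U => Q = P ∧ U = T) ?_ ?_ ⟨rfl, rfl⟩
  · rintro _ _ ⟨rfl, rfl⟩
    rw [← h]
    exact firstEnabled_ne_none_or_of_mem_syn hS
  · rintro _ _ ⟨rfl, rfl⟩ g U α μ hp hs P' hP'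
    exact .inr (mem_syn_of_step hS (h.trans hp) hs hP')

theorem mem_syn_of_uniqueStep (I : Proc → Sched → Prop)
    (hI : ∀ P S, I P S → S ∈ Syn P ∨ (∀ g, ¬ P.Enabled g) ∨
      ∃ g T α μ, P.firstEnabled S.leaves = some (g, T) ∧ UniqueStep P g ∧ Step P g α μ ∧
        ∀ P' ∈ μ.support, I P' T ∨ T ∈ Syn P') (h : I P S) : S ∈ Syn P := by
  refine mem_syn_of_invariant I (fun P S hPS => ?_) (fun P S hPS g' T' β ν hp' hs' P' hP' => ?_) h
  · rcases hI P S hPS with hS | hP | ⟨g, T, α, μ, hp, -⟩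
    · exact firstEnabled_ne_none_or_of_mem_syn hS
    · exact .inr hP
    · exact .inl (by simp [hp])
  · rcases hI P S hPS with hS | hP | ⟨g, T, α, μ, hp, hu, hs, hT⟩
    · exact .inr (mem_syn_of_step hS hp' hs' hP')
    · exact absurd ⟨β, ν, hs'⟩ (hP g')
    · obtain ⟨rfl, rfl⟩ := Prod.mk.inj (Option.some.inj (hp.symm.trans hp'))
      obtain ⟨-, rfl⟩ := hu _ _ _ _ hs hs'
      exact hT P' hP'

end Syn

/-! ### Restriction on several channels -/

/-- The restriction of `P` on all channels in a list. -/
def Proc.resAll (as : List Chan) (P : Proc) : Proc := as.foldr Proc.res P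

theorem Proc.resAll_injective (as : List Chan) : Function.Injective (Proc.resAll as) := by
  induction as with
  | nil => exact fun _ _ h => h
  | cons a as ih => exact fun _ _ h => ih (Proc.res.inj h).2

theorem step_resAll_iff {as : List Chan} {P : Proc} {g : Guard} {α : Act} {μ : PMF Proc} :
    Step (P.resAll as) g α μ ↔ (∀ a ∈ as, α ≠ .inp a ∧ α ≠ .out a) ∧
      ∃ μ', Step P g α μ' ∧ μ = μ'.map (Proc.resAll as) := by
  induction as generalizing μ with
  | nil =>
    have resAll_nil : Proc.resAll [] = id := rfl
    simp [resAll_nil, PMF.map_id]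
  | cons a as ih =>
    have resAll_cons : Proc.resAll (a :: as) = Proc.res a ∘ Proc.resAll as := rfl
    rw [resAll_cons, Function.comp_apply, List.forall_mem_cons]
    constructor
    · rintro (_ | ⟨hs, h1, h2⟩)
      obtain ⟨has, μ', hs', rfl⟩ := ih.1 hs
      exact ⟨⟨⟨h1, h2⟩, has⟩, μ', hs', PMF.map_comp ..⟩
    · rintro ⟨⟨⟨h1, h2⟩, has⟩, μ', hs, rfl⟩
      rw [← PMF.map_comp]
      exact .res (ih.2 ⟨has, μ', hs, rfl⟩) h1 h2

section Congr

variable {as bs : List Chan} (h : ∀ a, a ∈ as ↔ a ∈ bs)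

include h

theorem step_resAll_congr {P : Proc} {g : Guard} {α : Act} {μ : PMF Proc}
    (hs : Step P g α μ) (has : ∀ a ∈ as, α ≠ .inp a ∧ α ≠ .out a) :
    Step (P.resAll bs) g α (μ.map (Proc.resAll bs)) :=
  step_resAll_iff.2 ⟨fun a ha => has a ((h a).2 ha), μ, hs, rfl⟩

theorem enabled_resAll_congr (P : Proc) : (P.resAll as).Enabled = (P.resAll bs).Enabled := by
  have enabled_iff (cs : List Chan) (g : Guard) : (P.resAll cs).Enabled g ↔
      ∃ α, (∀ a ∈ cs, α ≠ .inp a ∧ α ≠ .out a) ∧ ∃ μ, Step P g α μ := by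
    simp only [Proc.Enabled, step_resAll_iff, exists_and_left]
    refine exists_congr fun α => and_congr_right fun _ => ?_
    exact ⟨fun ⟨_, μ', hs, _⟩ => ⟨μ', hs⟩, fun ⟨μ', hs⟩ => ⟨_, μ', hs, rfl⟩⟩
  funext g
  simp only [enabled_iff, h]

theorem firstEnabled_resAll_congr (P : Proc) (L : List (Guard × Sched)) :
    (P.resAll as).firstEnabled L = (P.resAll bs).firstEnabled L :=
  Proc.firstEnabled_congr (enabled_resAll_congr h P) L

theorem omegaWithin_resAll_le (n : ℕ) (P : Proc) (S : Sched) :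
    omegaWithin n (P.resAll as, S) ≤ omegaWithin n (P.resAll bs, S) := by
  have embedding_injective (cs : List Chan) :
      (Prod.map (Proc.resAll cs) (id : Sched → Sched)).Injective :=
    (Proc.resAll_injective cs).prodMap Function.injective_id
  refine omegaWithin_le_of_embedding (embedding_injective as) (embedding_injective bs) ?_ n (P, S)
  rintro ⟨P, S⟩ α m hm
  obtain ⟨g, T, μ, hp, hs, rfl⟩ := cstep_iff.1 hm
  obtain ⟨has, μ', hs', rfl⟩ := step_resAll_iff.1 hs
  have map_comm (cs : List Chan) : (μ'.map (Proc.resAll cs)).map (fun P' => (P', T)) =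
      (μ'.map fun P' => (P', T)).map (Prod.map (Proc.resAll cs) id) := by
    rw [PMF.map_comp, PMF.map_comp]
    rfl
  refine ⟨μ'.map fun P' => (P', T), map_comm as, cstep_iff.2 ⟨g, T, _, ?_,
    step_resAll_congr h hs' has, (map_comm bs).symm⟩⟩
  rw [← firstEnabled_resAll_congr h]
  exact hp

theorem syn_resAll_subset (P : Proc) : Syn (P.resAll as) ⊆ Syn (P.resAll bs) := by
  intro S hS
  refine mem_syn_of_invariant (fun R S => ∃ P, R = P.resAll bs ∧ S ∈ Syn (P.resAll as)) ?_ ?_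
    ⟨P, rfl, hS⟩
  · rintro _ S ⟨P, rfl, hS⟩
    rw [← firstEnabled_resAll_congr h, ← enabled_resAll_congr h]
    exact firstEnabled_ne_none_or_of_mem_syn hS
  · rintro _ S ⟨P, rfl, hS⟩ g T α μ hp hs _ hR
    obtain ⟨hbs, μ', hs', rfl⟩ := step_resAll_iff.1 hs
    obtain ⟨P', hP', rfl⟩ := (PMF.mem_support_map_iff _ _ _).1 hR
    rw [← firstEnabled_resAll_congr h] at hp
    refine .inl ⟨P', rfl, mem_syn_of_step hS hp
      (step_resAll_congr (fun _ => Iff.rfl) hs' fun a ha => hbs a ((h a).1 ha)) ?_⟩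
    exact (PMF.mem_support_map_iff _ _ _).2 ⟨P', hP', rfl⟩

end Congr

theorem omegaWithin_resAll_congr {as bs : List Chan} (h : ∀ a, a ∈ as ↔ a ∈ bs) (n : ℕ) (P : Proc)
    (S : Sched) : omegaWithin n (P.resAll as, S) = omegaWithin n (P.resAll bs, S) :=
  le_antisymm (omegaWithin_resAll_le h n P S) (omegaWithin_resAll_le (fun a => (h a).symm) n P S)

/-! ### Labels -/

/-- Every label in `ms` extends one in `ls`. The labels of a derivative are related in this way to
those of the process, as replication extends labels. -/
def Covers (ls ms : List Label) : Prop :=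
  ∀ M ∈ ms, ∃ L ∈ ls, L.atom = M.atom ∧ L.idx <+: M.idx

/-- Every label in `ls` is disjoint from every label in `ms`. -/
def DisjLabels (ls ms : List Label) : Prop := ∀ L ∈ ls, ∀ M ∈ ms, L.Disj M

theorem Label.Disj.symm {L M : Label} (h : L.Disj M) : M.Disj L :=
  fun ⟨h1, h2⟩ => h ⟨h1.symm, h2.symm⟩

theorem Label.not_disj_self (L : Label) : ¬ L.Disj L :=
  fun h => h ⟨rfl, .inl (List.prefix_refl _)⟩

theorem Label.Disj.extend {L M L' M' : Label} (h : L.Disj M) (hL : L.atom = L'.atom)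
    (hL' : L.idx <+: L'.idx) (hM : M.atom = M'.atom) (hM' : M.idx <+: M'.idx) : L'.Disj M' := by
  rintro ⟨h1, h2⟩
  refine h ⟨by rw [hL, hM, h1], ?_⟩
  rcases h2 with h2 | h2
  · exact List.prefix_or_prefix_of_prefix (hL'.trans h2) hM'
  · exact List.prefix_or_prefix_of_prefix hL' (hM'.trans h2)

section Covers

variable {ls ms ns ls' ms' : List Label}

theorem DisjLabels.symm (h : DisjLabels ls ms) : DisjLabels ms ls :=
  fun L hL M hM => (h M hM L hL).symm

theorem DisjLabels.of_covers (h : DisjLabels ls ms) (h1 : Covers ls ls') (h2 : Covers ms ms') :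
    DisjLabels ls' ms' := by
  intro L hL M hM
  obtain ⟨L₀, hL₀, e1, e2⟩ := h1 L hL
  obtain ⟨M₀, hM₀, e3, e4⟩ := h2 M hM
  exact (h L₀ hL₀ M₀ hM₀).extend e1 e2 e3 e4

theorem DisjLabels.mono (h : DisjLabels ls ms) (h1 : ls' ⊆ ls) (h2 : ms' ⊆ ms) :
    DisjLabels ls' ms' :=
  fun L hL M hM => h L (h1 hL) M (h2 hM)

theorem DisjLabels.not_mem (h : DisjLabels ls ms) {L : Label} (hL : L ∈ ls) : L ∉ ms :=
  fun hL' => L.not_disj_self (h L hL L hL')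

theorem Covers.of_subset (h : ms ⊆ ls) : Covers ls ms :=
  fun M hM => ⟨M, h hM, rfl, List.prefix_refl _⟩

theorem Covers.refl (ls : List Label) : Covers ls ls := .of_subset (List.Subset.refl _)

theorem Covers.trans (h1 : Covers ls ms) (h2 : Covers ms ns) : Covers ls ns := by
  intro N hN
  obtain ⟨M, hM, e1, e2⟩ := h2 N hN
  obtain ⟨L, hL, e3, e4⟩ := h1 M hM
  exact ⟨L, hL, e3.trans e1, e4.trans e2⟩

theorem Covers.append (h1 : Covers ls ls') (h2 : Covers ms ms') :
    Covers (ls ++ ms) (ls' ++ ms') := by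
  intro M hM
  rcases List.mem_append.1 hM with hM | hM
  · obtain ⟨L, hL, h⟩ := h1 M hM
    exact ⟨L, List.mem_append_left _ hL, h⟩
  · obtain ⟨L, hL, h⟩ := h2 M hM
    exact ⟨L, List.mem_append_right _ hL, h⟩

theorem covers_append_right : Covers ls (ms ++ ns) ↔ Covers ls ms ∧ Covers ls ns := by
  simp only [Covers, List.mem_append, or_imp, forall_and]

end Covers

theorem labels_relabel (P : Proc) (k : List Bool) :
    (P.relabel k).labels = P.labels.map fun L => L.ext k := by
  induction P with
  | psum l w P ih =>
    simp only [Proc.relabel, Proc.labels, List.map_cons, List.map_flatten, List.map_ofFn]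
    congr 4
    exact funext ih
  | _ => simp_all [Proc.relabel, Proc.labels]

theorem covers_relabel (P : Proc) (k : List Bool) : Covers P.labels (P.relabel k).labels := by
  rw [labels_relabel]
  intro M hM
  obtain ⟨L, hL, rfl⟩ := List.mem_map.1 hM
  exact ⟨L, hL, rfl, List.prefix_append _ _⟩

theorem labels_sublist_psum {n : ℕ} (l : Label) (w : PMF (Fin n)) (P : Fin n → Proc) (i : Fin n) :
    (P i).labels.Sublist (Proc.psum l w P).labels :=
  .cons _ (List.sublist_flatten_of_mem (List.mem_ofFn.2 ⟨i, rfl⟩))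

/-- The labels in a guard. -/
def Guard.labels : Guard → List Label
  | .one l => [l]
  | .two l m => [l, m]

section Step

variable {P : Proc} {g : Guard} {α : Act} {μ : PMF Proc}

theorem Step.guard_subset (h : Step P g α μ) : g.labels ⊆ P.labels := by
  induction h with
  | act | prob => simp [Guard.labels, Proc.labels]
  | res _ _ _ ih | bang1 _ ih => exact ih
  | sum1 _ ih | par1 _ ih => exact List.subset_append_of_subset_left _ ih
  | sum2 _ ih | par2 _ ih => exact List.subset_append_of_subset_right _ ih
  | com _ _ _ ih1 ih2 | bang2 _ _ _ ih1 ih2 =>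
    simp only [Guard.labels, List.cons_subset, List.nil_subset, and_true] at ih1 ih2 ⊢
    simp [Proc.labels, ih1, ih2]

theorem Step.covers (h : Step P g α μ) : ∀ P' ∈ μ.support, Covers P.labels P'.labels := by
  induction h with
  | act =>
    simp only [PMF.support_pure, Set.mem_singleton_iff, forall_eq]
    exact .of_subset (List.subset_cons_self _ _)
  | prob l w P =>
    simp only [PMF.support_map, Set.forall_mem_image]
    exact fun i _ => .of_subset (labels_sublist_psum l w P i).subset
  | res _ _ _ ih =>
    simp only [PMF.support_map, Set.forall_mem_image]
    exact ih
  | sum1 _ ih => exact fun P' h => (Covers.of_subset (List.subset_append_left _ _)).trans (ih P' h)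
  | sum2 _ ih => exact fun P' h => (Covers.of_subset (List.subset_append_right _ _)).trans (ih P' h)
  | par1 _ ih =>
    simp only [PMF.support_map, Set.forall_mem_image]
    exact fun P' h => (ih P' h).append (.refl _)
  | par2 _ ih =>
    simp only [PMF.support_map, Set.forall_mem_image]
    exact fun P' h => (Covers.refl _).append (ih P' h)
  | com _ _ _ ih1 ih2 =>
    simp only [PMF.support_pure, Set.mem_singleton_iff, forall_eq] at ih1 ih2 ⊢
    exact ih1.append ih2
  | bang1 _ ih =>
    simp only [PMF.support_map, Set.forall_mem_image]
    exact fun P' h => covers_append_right.2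
      ⟨(ih P' h).trans (covers_relabel _ _), covers_relabel (.bang _) _⟩
  | bang2 _ _ _ ih1 ih2 =>
    simp only [PMF.support_pure, Set.mem_singleton_iff, forall_eq] at ih1 ih2 ⊢
    exact covers_append_right.2 ⟨covers_append_right.2 ⟨ih1.trans (covers_relabel _ _),
      ih2.trans (covers_relabel _ _)⟩, covers_relabel (.bang _) _⟩

theorem Step.eq_pure (h : Step P g α μ) (hα : α ≠ .tau) : ∃ P', μ = PMF.pure P' := by
  induction h with
  | act _ _ P => exact ⟨P, rfl⟩
  | sum1 _ ih | sum2 _ ih => exact ih hα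
  | res _ _ _ ih | par1 _ ih | par2 _ ih | bang1 _ ih =>
    obtain ⟨P', rfl⟩ := ih hα
    exact ⟨_, PMF.pure_map _ _⟩
  | prob | com | bang2 => exact absurd rfl hα

end Step

theorem Act.Compl.ne_tau {α β : Act} (h : α.Compl β) : α ≠ .tau ∧ β ≠ .tau := by
  obtain ⟨a, ⟨rfl, rfl⟩ | ⟨rfl, rfl⟩⟩ := h <;> simp

theorem pure_injective {α : Type*} : Function.Injective (PMF.pure : α → PMF α) := fun a b h => by
  simpa only [PMF.support_pure, Set.singleton_eq_singleton_iff] using congrArg PMF.support h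

/-! ### Deterministic labelings -/

/-- `P` has at most one transition by every guard. -/
def StepDet (P : Proc) : Prop := ∀ g, UniqueStep P g

theorem deterministic_iff {P : Proc} : Deterministic P ↔ ∀ P', PReach P P' → StepDet P' := by
  refine forall₂_congr fun P' _ => ⟨fun h g α β μ ν hμ hν => ?_, fun h S α β m m' hm hm' => ?_⟩
  · obtain ⟨hα, hmap⟩ := h _ α β _ _ (hμ.cstep_guard (.ofLeaves [])) (hν.cstep_guard _)
    refine ⟨hα, ?_⟩
    have map_fst (ξ : PMF Proc) (T : Sched) : (ξ.map fun P' => (P', T)).map Prod.fst = ξ := by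
      rw [PMF.map_comp]
      exact PMF.map_id ξ
    rw [← map_fst μ, hmap, map_fst]
  · obtain ⟨g, T, μ, hp, hμ, rfl⟩ := cstep_iff.1 hm
    obtain ⟨rfl, rfl⟩ := ((h g).cstep_iff hp hμ β m').1 hm'
    exact ⟨rfl, rfl⟩

theorem Deterministic.stepDet {P : Proc} (hP : Deterministic P) : StepDet P :=
  deterministic_iff.1 hP P .refl

section Step

variable {P P' Q : Proc} {g g' : Guard} {α β : Act} {μ ν : PMF Proc}

theorem PReach.head {P'' : Proc} (h : Step P g α μ) (hP' : P' ∈ μ.support)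
    (h' : PReach P' P'') : PReach P P'' := by
  induction h' with
  | refl =>
    refine .step (S' := .ofLeaves []) .refl (h.cstep_guard (.ofLeaves [])) ?_
    exact (PMF.mem_support_iff _ _).1 ((PMF.mem_support_map_iff _ _ _).2 ⟨P', hP', rfl⟩)
  | step _ hs hm ih => exact .step ih hs hm

theorem Deterministic.of_step (hP : Deterministic P) (h : Step P g α μ) (hP' : P' ∈ μ.support) :
    Deterministic P' :=
  fun _ h' => hP _ (h'.head h hP')

theorem Step.not_disjLabels (h1 : Step P g α μ) (h2 : Step Q g' β ν)
    (h : ∃ L ∈ g.labels, L ∈ g'.labels) : ¬ DisjLabels P.labels Q.labels := by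
  obtain ⟨L, hL, hL'⟩ := h
  exact fun hd => hd.not_mem (h1.guard_subset hL) (h2.guard_subset hL')

theorem Step.not_disjLabels_self (h1 : Step P g α μ) (h2 : Step Q g β ν) :
    ¬ DisjLabels P.labels Q.labels :=
  h1.not_disjLabels h2 (by cases g <;> simp [Guard.labels])

end Step

section StepDet

variable {P Q : Proc}

theorem stepDet_nil : StepDet .nil := fun _ _ _ _ _ h => nomatch h

theorem stepDet_pre (l : Label) (α : Act) (P : Proc) : StepDet (.pre l α P) := by
  rintro _ _ _ _ _ ⟨⟩ ⟨⟩
  exact ⟨rfl, rfl⟩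

theorem stepDet_psum {n : ℕ} (l : Label) (w : PMF (Fin n)) (P : Fin n → Proc) :
    StepDet (.psum l w P) := by
  intro g β γ μ ν h1 h2
  cases h1
  cases h2
  exact ⟨rfl, rfl⟩

theorem StepDet.res (h : StepDet P) (a : Chan) : StepDet (.res a P) := by
  intro g β γ μ ν h1 h2
  cases h1 with
  | res h1 =>
    cases h2 with
    | res h2 =>
      obtain ⟨rfl, rfl⟩ := h g _ _ _ _ h1 h2
      exact ⟨rfl, rfl⟩

theorem StepDet.sum (hP : StepDet P) (hQ : StepDet Q) (hd : DisjLabels P.labels Q.labels) :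
    StepDet (.sum P Q) := by
  intro g β γ μ ν h1 h2
  cases h1 with
  | sum1 h1 =>
    cases h2 with
    | sum1 h2 => exact hP g _ _ _ _ h1 h2
    | sum2 h2 => exact absurd hd (h1.not_disjLabels_self h2)
  | sum2 h1 =>
    cases h2 with
    | sum1 h2 => exact absurd hd (h2.not_disjLabels_self h1)
    | sum2 h2 => exact hQ g _ _ _ _ h1 h2

theorem StepDet.par (hP : StepDet P) (hQ : StepDet Q) (hd : DisjLabels P.labels Q.labels) :
    StepDet (.par P Q) := by
  intro g β γ μ ν h1 h2
  cases h1 with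
  | par1 h1 =>
    cases h2 with
    | par1 h2 =>
      obtain ⟨rfl, rfl⟩ := hP g _ _ _ _ h1 h2
      exact ⟨rfl, rfl⟩
    | par2 h2 => exact absurd hd (h1.not_disjLabels_self h2)
    | com _ h3 => exact absurd hd (h1.not_disjLabels h3 (by simp [Guard.labels]))
  | par2 h1 =>
    cases h2 with
    | par1 h2 => exact absurd hd (h2.not_disjLabels_self h1)
    | par2 h2 =>
      obtain ⟨rfl, rfl⟩ := hQ g _ _ _ _ h1 h2
      exact ⟨rfl, rfl⟩
    | com h2 _ => exact absurd hd (h2.not_disjLabels h1 (by simp [Guard.labels]))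
  | com h1 h3 =>
    cases h2 with
    | par1 h2 => exact absurd hd (h2.not_disjLabels h3 (by simp [Guard.labels]))
    | par2 h2 => exact absurd hd (h1.not_disjLabels h2 (by simp [Guard.labels]))
    | com h2 h4 =>
      obtain rfl := pure_injective (hP _ _ _ _ _ h1 h2).2
      obtain rfl := pure_injective (hQ _ _ _ _ _ h3 h4).2
      exact ⟨rfl, rfl⟩

end StepDet

theorem Step.bangFree {P : Proc} {g : Guard} {α : Act} {μ : PMF Proc} (h : Step P g α μ)
    (hP : P.BangFree) : ∀ P' ∈ μ.support, P'.BangFree ∧ P'.labels.Sublist P.labels := by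
  induction h with
  | act =>
    simp only [PMF.support_pure, Set.mem_singleton_iff, forall_eq]
    exact ⟨hP, List.sublist_cons_self _ _⟩
  | prob l w P =>
    simp only [PMF.support_map, Set.forall_mem_image]
    exact fun i _ => ⟨hP i, labels_sublist_psum l w P i⟩
  | res _ _ _ ih =>
    simp only [PMF.support_map, Set.forall_mem_image]
    exact ih hP
  | sum1 _ ih =>
    exact fun P' h => ⟨(ih hP.1 P' h).1, (ih hP.1 P' h).2.trans (List.sublist_append_left _ _)⟩
  | sum2 _ ih =>
    exact fun P' h => ⟨(ih hP.2 P' h).1, (ih hP.2 P' h).2.trans (List.sublist_append_right _ _)⟩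
  | par1 _ ih =>
    simp only [PMF.support_map, Set.forall_mem_image]
    exact fun P' h => ⟨⟨(ih hP.1 P' h).1, hP.2⟩, (ih hP.1 P' h).2.append (.refl _)⟩
  | par2 _ ih =>
    simp only [PMF.support_map, Set.forall_mem_image]
    exact fun P' h => ⟨⟨hP.1, (ih hP.2 P' h).1⟩,
      (List.Sublist.refl _).append (ih hP.2 P' h).2⟩
  | com _ _ _ ih1 ih2 =>
    simp only [PMF.support_pure, Set.mem_singleton_iff, forall_eq] at ih1 ih2 ⊢
    exact ⟨⟨(ih1 hP.1).1, (ih2 hP.2).1⟩, (ih1 hP.1).2.append (ih2 hP.2).2⟩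
  | bang1 | bang2 => exact hP.elim

theorem linear_append {ls ms : List Label} :
    Linear (ls ++ ms) ↔ Linear ls ∧ Linear ms ∧ DisjLabels ls ms := List.pairwise_append

theorem stepDet_of_linear {P : Proc} (hP : P.BangFree) (hl : Linear P.labels) : StepDet P := by
  induction P with
  | pre l α P => exact stepDet_pre l α P
  | psum l w P => exact stepDet_psum l w P
  | nil => exact stepDet_nil
  | bang => exact hP.elim
  | res a P ih => exact (ih hP hl).res a
  | sum P Q ihP ihQ =>
    obtain ⟨hlP, hlQ, hd⟩ := linear_append.1 hl
    exact (ihP hP.1 hlP).sum (ihQ hP.2 hlQ) hd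
  | par P Q ihP ihQ =>
    obtain ⟨hlP, hlQ, hd⟩ := linear_append.1 hl
    exact (ihP hP.1 hlP).par (ihQ hP.2 hlQ) hd

theorem deterministic_of_linear {P : Proc} (hP : P.BangFree) (hl : Linear P.labels) :
    Deterministic P := by
  suffices reach_linear : ∀ P', PReach P P' → P'.BangFree ∧ Linear P'.labels from
    deterministic_iff.2 fun P' h => stepDet_of_linear (reach_linear P' h).1 (reach_linear P' h).2
  intro P' h
  induction h with
  | refl => exact ⟨hP, hl⟩
  | step _ hs hm ih =>
    obtain ⟨g, T, μ, -, hst, rfl⟩ := cstep_iff.1 hs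
    obtain ⟨R, hR, h⟩ := (PMF.mem_support_map_iff _ _ _).1 ((PMF.mem_support_iff _ _).2 hm)
    obtain ⟨rfl, rfl⟩ := Prod.mk.inj h
    obtain ⟨hfree, hsub⟩ := hst.bangFree ih.1 R hR
    exact ⟨hfree, ih.2.sublist hsub⟩

/-! ### Contexts as functions -/

/-- Contexts with at most one active hole, as functions of the process in the hole. The other
components have deterministic labelings, and their labels are disjoint from those of the part
with the hole where both can be active. In contrast to `Ctx`, this class is closed under
transitions. -/
inductive HoleCtx : (Proc → Proc) → Prop
  | hole : HoleCtx fun X => X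
  | const {R : Proc} : Deterministic R → HoleCtx fun _ => R
  | pre {F : Proc → Proc} (l : Label) (α : Act) : HoleCtx F → HoleCtx fun X => .pre l α (F X)
  | psum {n : ℕ} (l : Label) (w : PMF (Fin n)) {F : Fin n → Proc → Proc} :
      (∀ i, HoleCtx (F i)) → HoleCtx fun X => .psum l w fun i => F i X
  | res {F : Proc → Proc} (a : Chan) : HoleCtx F → HoleCtx fun X => .res a (F X)
  | parL {F : Proc → Proc} {R : Proc} : HoleCtx F → Deterministic R →
      DisjLabels (F .nil).labels R.labels → HoleCtx fun X => .par (F X) R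
  | parR {F : Proc → Proc} {R : Proc} : HoleCtx F → Deterministic R →
      DisjLabels (F .nil).labels R.labels → HoleCtx fun X => .par R (F X)
  | sumL {F : Proc → Proc} {R : Proc} : HoleCtx F → Deterministic R →
      DisjLabels (F .nil).labels R.labels → HoleCtx fun X => .sum (F X) R
  | sumR {F : Proc → Proc} {R : Proc} : HoleCtx F → Deterministic R →
      DisjLabels (F .nil).labels R.labels → HoleCtx fun X => .sum R (F X)

/-- The only transition of `X` is a silent one to `χ`, by the guard `σ(a)`. -/
def Proc.SilentTo (X : Proc) (a : Label) (χ : PMF Proc) : Prop :=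
  ∀ g α μ, Step X g α μ ↔ g = .one a ∧ α = .tau ∧ μ = χ

theorem silentTo_pre (l : Label) (P : Proc) : (Proc.pre l .tau P).SilentTo l (PMF.pure P) := by
  intro g α μ
  constructor
  · rintro ⟨⟩
    exact ⟨rfl, rfl, rfl⟩
  · rintro ⟨rfl, rfl, rfl⟩
    exact .act _ _ _

theorem silentTo_psum {n : ℕ} (l : Label) (w : PMF (Fin n)) (P : Fin n → Proc) :
    (Proc.psum l w P).SilentTo l (w.map P) := by
  intro g α μ
  constructor
  · intro h
    cases h
    exact ⟨rfl, rfl, rfl⟩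
  · rintro ⟨rfl, rfl, rfl⟩
    exact .prob _ _ _

section SilentTo

variable {X : Proc} {a : Label} {χ : PMF Proc}

theorem Proc.SilentTo.step (h : X.SilentTo a χ) : Step X (.one a) .tau χ :=
  (h _ _ _).2 ⟨rfl, rfl, rfl⟩

theorem Proc.SilentTo.mem_labels (h : X.SilentTo a χ) : a ∈ X.labels :=
  h.step.guard_subset (List.mem_cons_self ..)

theorem Proc.SilentTo.stepDet (h : X.SilentTo a χ) : StepDet X := by
  intro g α β μ ν hμ hν
  obtain ⟨-, rfl, rfl⟩ := (h _ _ _).1 hμ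
  obtain ⟨-, rfl, rfl⟩ := (h _ _ _).1 hν
  exact ⟨rfl, rfl⟩

end SilentTo

theorem HoleCtx.mem_labels {F : Proc → Proc} (hF : HoleCtx F) {X : Proc} {M : Label}
    (h : M ∈ (F X).labels) : M ∈ (F .nil).labels ∨ M ∈ X.labels := by
  induction hF with
  | hole => exact .inr h
  | const => exact .inl h
  | res a _ ih => exact ih h
  | pre l α _ ih =>
    simp only [Proc.labels, List.mem_cons] at h ⊢
    tauto
  | psum l w _ ih =>
    simp only [Proc.labels, List.mem_cons, List.mem_flatten, List.mem_ofFn] at h ⊢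
    rcases h with h | ⟨_, ⟨i, rfl⟩, h⟩
    · exact .inl (.inl h)
    · exact (ih i h).imp (fun h => .inr ⟨_, ⟨i, rfl⟩, h⟩) id
  | parL _ _ _ ih | parR _ _ _ ih | sumL _ _ _ ih | sumR _ _ _ ih =>
    simp only [Proc.labels, List.mem_append] at h ⊢
    tauto

theorem HoleCtx.disjLabels {F : Proc → Proc} (hF : HoleCtx F) {X : Proc} {ls : List Label}
    (hFls : DisjLabels (F .nil).labels ls) (hX : DisjLabels ls X.labels) :
    DisjLabels (F X).labels ls :=
  fun M hM => (hF.mem_labels hM).elim (hFls M) (hX.symm M)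

theorem HoleCtx.stepDet {F : Proc → Proc} (hF : HoleCtx F) {X : Proc} (hX : StepDet X)
    (hd : DisjLabels (F .nil).labels X.labels) : StepDet (F X) := by
  have left {ls ms : List Label} (h : DisjLabels (ls ++ ms) X.labels) : DisjLabels ls X.labels :=
    h.mono (List.subset_append_left _ _) (List.Subset.refl _)
  have right {ls ms : List Label} (h : DisjLabels (ls ++ ms) X.labels) : DisjLabels ms X.labels :=
    h.mono (List.subset_append_right _ _) (List.Subset.refl _)
  induction hF with
  | hole => exact hX
  | const h => exact h.stepDet
  | pre l α => exact stepDet_pre _ _ _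
  | psum l w => exact stepDet_psum _ _ _
  | res a _ ih => exact (ih hd).res a
  | parL hF hR hFR ih => exact (ih (left hd)).par hR.stepDet (hF.disjLabels hFR (right hd))
  | parR hF hR hFR ih => exact hR.stepDet.par (ih (right hd)) (hF.disjLabels hFR (left hd)).symm
  | sumL hF hR hFR ih => exact (ih (left hd)).sum hR.stepDet (hF.disjLabels hFR (right hd))
  | sumR hF hR hFR ih => exact hR.stepDet.sum (ih (right hd)) (hF.disjLabels hFR (left hd)).symm

/-- A transition of the context `F` that does not involve the process in the hole. -/
structure CtxStep (F : Proc → Proc) (g : Guard) (α : Act) (ν : PMF (Proc → Proc)) : Prop where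
  step : ∀ X, Step (F X) g α (ν.map fun G => G X)
  holeCtx : ∀ G ∈ ν.support, HoleCtx G
  eq_pure : α ≠ .tau → ∃ G, ν = PMF.pure G

section CtxStep

variable {F F' : Proc → Proc} {g : Guard} {α : Act} {ν : PMF (Proc → Proc)}

theorem CtxStep.guard_subset (h : CtxStep F g α ν) : g.labels ⊆ (F .nil).labels :=
  (h.step .nil).guard_subset

theorem CtxStep.covers {G : Proc → Proc} (h : CtxStep F g α ν) (hG : G ∈ ν.support) :
    Covers (F .nil).labels (G .nil).labels :=
  (h.step .nil).covers _ ((PMF.mem_support_map_iff _ _ _).2 ⟨G, hG, rfl⟩)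

theorem CtxStep.lift (h : CtxStep F g α ν) (k : Proc → Proc)
    (hstep : ∀ X μ, Step (F X) g α μ → Step (F' X) g α (μ.map k))
    (hk : ∀ G, HoleCtx G → Covers (F .nil).labels (G .nil).labels → HoleCtx fun X => k (G X)) :
    CtxStep F' g α (ν.map fun G X => k (G X)) where
  step X := by
    have := hstep X _ (h.step X)
    rw [PMF.map_comp] at this ⊢
    exact this
  holeCtx := by
    simp only [PMF.support_map, Set.forall_mem_image]
    exact fun G hG => hk G (h.holeCtx G hG) (h.covers hG)
  eq_pure hα := by
    obtain ⟨G, rfl⟩ := h.eq_pure hα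
    exact ⟨_, PMF.pure_map _ _⟩

theorem ctxStep_of_step {R : Proc} {μ : PMF Proc} (h : Step R g α μ)
    {K : Proc → Proc → Proc} (hstep : ∀ X, Step (F X) g α (μ.map fun R' => K R' X))
    (hK : ∀ R' ∈ μ.support, HoleCtx (K R')) : CtxStep F g α (μ.map K) where
  step X := by
    rw [PMF.map_comp]
    exact hstep X
  holeCtx := by
    simpa only [PMF.support_map, Set.forall_mem_image] using hK
  eq_pure hα := by
    obtain ⟨R', rfl⟩ := h.eq_pure hα
    exact ⟨_, PMF.pure_map _ _⟩

theorem ctxStep_pure {G : Proc → Proc} (hstep : ∀ X, Step (F X) g α (PMF.pure (G X)))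
    (hG : HoleCtx G) : CtxStep F g α (PMF.pure G) where
  step X := by
    rw [PMF.pure_map]
    exact hstep X
  holeCtx := by
    simpa only [PMF.support_pure, Set.mem_singleton_iff, forall_eq] using hG
  eq_pure _ := ⟨G, rfl⟩

end CtxStep

/-- The context `F` lets the process in the hole make silent transitions, and then becomes `H`. -/
def HoleStep (F H : Proc → Proc) : Prop :=
  ∀ X a μ, Step X (.one a) .tau μ → Step (F X) (.one a) .tau (μ.map H)

/-- The transitions of `F X` for a context `F`, when the only transition of `X` is a silent one
to `χ`, by the guard `σ(a)`: those of the context and that of `X`. -/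
inductive FillStep (F : Proc → Proc) (X : Proc) (a : Label) (χ : PMF Proc) :
    Guard → Act → PMF Proc → Prop
  | ctx {g : Guard} {α : Act} {ν : PMF (Proc → Proc)} :
      CtxStep F g α ν → FillStep F X a χ g α (ν.map fun G => G X)
  | hole {H : Proc → Proc} : HoleStep F H → FillStep F X a χ (.one a) .tau (χ.map H)

section FillStep

variable {F F' : Proc → Proc} {R X : Proc} {a : Label} {χ : PMF Proc} {g : Guard} {α : Act}
  {μ : PMF Proc}

theorem FillStep.lift (h : FillStep F X a χ g α μ) (k : Proc → Proc)
    (hstep : ∀ Y g μ, Step (F Y) g α μ → Step (F' Y) g α (μ.map k))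
    (hk : ∀ G, HoleCtx G → Covers (F .nil).labels (G .nil).labels → HoleCtx fun Y => k (G Y)) :
    FillStep F' X a χ g α (μ.map k) := by
  cases h with
  | ctx h =>
    have := FillStep.ctx (X := X) (a := a) (χ := χ) (h.lift k (fun Y => hstep Y g) hk)
    rwa [PMF.map_comp] at this ⊢
  | hole h =>
    rw [PMF.map_comp]
    refine .hole fun Y b μ hY => ?_
    simpa only [PMF.map_comp] using hstep Y _ _ (h Y b μ hY)

theorem FillStep.mono (h : FillStep F X a χ g α μ)
    (hstep : ∀ Y g μ, Step (F Y) g α μ → Step (F' Y) g α μ) : FillStep F' X a χ g α μ := by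
  have := h.lift id (fun Y g μ hs => (PMF.map_id μ).symm ▸ hstep Y g μ hs) fun G hG _ => hG
  rwa [PMF.map_id] at this

theorem fillStep_of_sibling (hs : Step R g α μ) (K : Proc → Proc → Proc)
    (hstep : ∀ Y, Step (F Y) g α (μ.map fun R' => K R' Y))
    (hK : ∀ R' ∈ μ.support, HoleCtx (K R')) :
    FillStep F X a χ g α (μ.map fun R' => K R' X) := by
  have := FillStep.ctx (X := X) (a := a) (χ := χ) (ctxStep_of_step hs hstep hK)
  rwa [PMF.map_comp] at this

theorem fillStep_of_summand (hR : Deterministic R) (hs : Step R g α μ)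
    (hstep : ∀ Y, Step (F Y) g α μ) : FillStep F X a χ g α μ := by
  have := fillStep_of_sibling (F := F) (X := X) (a := a) (χ := χ) hs (fun R' _ => R')
    (fun Y => (PMF.map_id μ).symm ▸ hstep Y) fun R' hR' => .const (hR.of_step hs hR')
  rwa [show (fun R' : Proc => R') = id from rfl, PMF.map_id] at this

theorem FillStep.com {P' : Proc} {g' : Guard} (h : FillStep F X a χ g α (PMF.pure P'))
    (hα : α ≠ .tau) (k : Proc → Proc)
    (hstep : ∀ Y P', Step (F Y) g α (PMF.pure P') → Step (F' Y) g' .tau (PMF.pure (k P')))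
    (hk : ∀ G, HoleCtx G → Covers (F .nil).labels (G .nil).labels → HoleCtx fun Y => k (G Y)) :
    FillStep F' X a χ g' .tau (PMF.pure (k P')) := by
  generalize hμ : PMF.pure P' = μ at h
  cases h with
  | hole => exact absurd rfl hα
  | ctx h =>
    obtain ⟨G, rfl⟩ := h.eq_pure hα
    have G_mem : G ∈ (PMF.pure G).support := by simp
    rw [PMF.pure_map] at hμ
    obtain rfl := pure_injective hμ
    have := FillStep.ctx (X := X) (a := a) (χ := χ) (ctxStep_pure (F := F') (g := g') (α := .tau)
      (fun Y => hstep Y _ (by simpa only [PMF.pure_map] using h.step Y))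
      (hk G (h.holeCtx G G_mem) (h.covers G_mem)))
    rwa [PMF.pure_map] at this

theorem fillStep_parL (ih : ∀ g α μ, Step (F X) g α μ → FillStep F X a χ g α μ) (hF : HoleCtx F)
    (hR : Deterministic R) (hd : DisjLabels (F .nil).labels R.labels)
    (h : Step (.par (F X) R) g α μ) : FillStep (fun Y => .par (F Y) R) X a χ g α μ := by
  cases h with
  | par1 h =>
    exact (ih _ _ _ h).lift _ (fun Y g μ hs => .par1 hs)
      fun G hG hc => hG.parL hR (hd.of_covers hc (.refl _))
  | par2 h =>
    exact fillStep_of_sibling h (fun R' Y => .par (F Y) R') (fun _ => .par2 h)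
      fun R' hR' => hF.parL (hR.of_step h hR') (hd.of_covers (.refl _) (h.covers R' hR'))
  | @com _ _ P' R' _ _ _ _ h h' hc =>
    have R'_mem : R' ∈ (PMF.pure R').support := by simp
    exact (ih _ _ _ h).com hc.ne_tau.1 (fun P' => .par P' R') (fun Y P' hs => .com hs h' hc)
      fun G hG hcov => hG.parL (hR.of_step h' R'_mem) (hd.of_covers hcov (h'.covers R' R'_mem))

theorem fillStep_parR (ih : ∀ g α μ, Step (F X) g α μ → FillStep F X a χ g α μ) (hF : HoleCtx F)
    (hR : Deterministic R) (hd : DisjLabels (F .nil).labels R.labels)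
    (h : Step (.par R (F X)) g α μ) : FillStep (fun Y => .par R (F Y)) X a χ g α μ := by
  cases h with
  | par2 h =>
    exact (ih _ _ _ h).lift _ (fun Y g μ hs => .par2 hs)
      fun G hG hc => hG.parR hR (hd.of_covers hc (.refl _))
  | par1 h =>
    exact fillStep_of_sibling h (fun R' Y => .par R' (F Y)) (fun _ => .par1 h)
      fun R' hR' => hF.parR (hR.of_step h hR') (hd.of_covers (.refl _) (h.covers R' hR'))
  | @com _ _ R' P' _ _ _ _ h' h hc =>
    have R'_mem : R' ∈ (PMF.pure R').support := by simp
    exact (ih _ _ _ h).com hc.ne_tau.2 (fun P' => .par R' P') (fun Y P' hs => .com h' hs hc)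
      fun G hG hcov => hG.parR (hR.of_step h' R'_mem) (hd.of_covers hcov (h'.covers R' R'_mem))

theorem HoleCtx.fillStep_of_step (hF : HoleCtx F) (hX : X.SilentTo a χ) (h : Step (F X) g α μ) :
    FillStep F X a χ g α μ := by
  induction hF generalizing g α μ with
  | hole =>
    obtain ⟨rfl, rfl, rfl⟩ := (hX _ _ _).1 h
    have := FillStep.hole (F := fun X => X) (X := X) (a := a) (χ := μ) (H := id)
      fun Y b ν hY => (PMF.map_id ν).symm ▸ hY
    rwa [PMF.map_id] at this
  | const hR => exact fillStep_of_summand hR h fun _ => h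
  | @pre F l α hF =>
    cases h
    have := FillStep.ctx (X := X) (a := a) (χ := χ) (ctxStep_pure (fun Y => .act l α (F Y)) hF)
    rwa [PMF.pure_map] at this
  | @psum n l w F hF =>
    cases h
    have := FillStep.ctx (X := X) (a := a) (χ := χ) (g := .one l) (α := .tau)
      (F := fun X => .psum l w fun i => F i X) (ν := w.map F)
      ⟨fun Y => by rw [PMF.map_comp]; exact .prob _ _ _, by simpa using fun i _ => hF i,
        fun h => absurd rfl h⟩
    rwa [PMF.map_comp] at this
  | res a _ ih =>
    cases h with
    | res h h1 h2 => exact (ih h).lift _ (fun Y g μ hs => .res hs h1 h2) fun G hG _ => hG.res a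
  | sumL _ hR _ ih =>
    cases h with
    | sum1 h => exact (ih h).mono fun Y g μ hs => .sum1 hs
    | sum2 h => exact fillStep_of_summand hR h fun _ => .sum2 h
  | sumR _ hR _ ih =>
    cases h with
    | sum1 h => exact fillStep_of_summand hR h fun _ => .sum1 h
    | sum2 h => exact (ih h).mono fun Y g μ hs => .sum2 hs
  | parL hF hR hd ih => exact fillStep_parL (fun _ _ _ => ih) hF hR hd h
  | parR hF hR hd ih => exact fillStep_parR (fun _ _ _ => ih) hF hR hd h

end FillStep

theorem Ctx.holeCtx_fill {C : Ctx} (hb : C.BangFree) (hl : Linear C.labels) :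
    HoleCtx fun X => C.fill X := by
  induction C with
  | hole => exact .hole
  | pre l α C ih => exact (ih hb hl.of_cons).pre l α
  | res a C ih => exact (ih hb hl).res a
  | bang C => exact hb.elim
  | parL C R ih =>
    obtain ⟨hlC, hlR, hd⟩ := linear_append.1 hl
    exact (ih hb.1 hlC).parL (deterministic_of_linear hb.2 hlR) hd
  | parR R C ih =>
    obtain ⟨hlR, hlC, hd⟩ := linear_append.1 hl
    exact (ih hb.2 hlC).parR (deterministic_of_linear hb.1 hlR) hd.symm
  | sumL C R ih =>
    obtain ⟨hlC, hlR, hd⟩ := linear_append.1 hl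
    exact (ih hb.1 hlC).sumL (deterministic_of_linear hb.2 hlR) hd
  | sumR R C ih =>
    obtain ⟨hlR, hlC, hd⟩ := linear_append.1 hl
    exact (ih hb.2 hlC).sumR (deterministic_of_linear hb.1 hlR) hd.symm
  | psum l w i C P ih =>
    refine .psum l w fun j => ?_
    have hbj := hb j
    have hlj : Linear _ := hl.sublist (labels_sublist_psum l w _ j)
    by_cases hj : j = i
    · simp only [hj, dite_true] at hbj hlj ⊢
      exact ih hbj hlj
    · simp only [hj, dite_false] at hbj hlj ⊢
      exact .const (deterministic_of_linear hbj hlj)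

theorem HoleCtx.resAll {F : Proc → Proc} (hF : HoleCtx F) (as : List Chan) :
    HoleCtx fun X => (F X).resAll as := by
  induction as with
  | nil => exact hF
  | cons a as ih => exact ih.res a

theorem labels_resAll (as : List Chan) (P : Proc) : (P.resAll as).labels = P.labels := by
  induction as with
  | nil => rfl
  | cons _ _ ih => exact ih

/-! ### Mixtures -/

/-- The schedulers that are non-blocking for every process in the mixture `μ`. -/
def MixSyn (μ : PMF Proc) : Set Sched := {S | ∀ A ∈ μ.support, S ∈ Syn A}

/-- The probability that `ω` occurs when the scheduler `S` runs a process that is drawn from the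
mixture `μ`, and `S` does not see the outcome of the draw. -/
noncomputable def mixOmega (μ : PMF Proc) (S : Sched) : ℝ≥0∞ :=
  ⨆ n, expect μ fun A => omegaWithin n (A, S)

/-- Every non-blocking scheduler for the mixture `μ` is matched by one for the mixture `ν` with
the same success probability. -/
def Matches (μ ν : PMF Proc) : Prop :=
  ∀ S ∈ MixSyn μ, ∃ T ∈ MixSyn ν, mixOmega μ S = mixOmega ν T

instance : IsTrans (PMF Proc) Matches where
  trans _ _ _ h h' S hS := by
    obtain ⟨T, hT, hST⟩ := h S hS
    obtain ⟨U, hU, hTU⟩ := h' T hT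
    exact ⟨U, hU, hST.trans hTU⟩

theorem mem_mixSyn_pure {A : Proc} {S : Sched} : S ∈ MixSyn (PMF.pure A) ↔ S ∈ Syn A := by
  simp [MixSyn]

theorem mixOmega_pure (A : Proc) (S : Sched) :
    mixOmega (PMF.pure A) S = ⨆ n, omegaWithin n (A, S) := by
  simp only [mixOmega, expect_pure]

theorem mem_mixSyn_map {ι : Type*} {π : PMF ι} {A : ι → Proc} {S : Sched} :
    S ∈ MixSyn (π.map A) ↔ ∀ i ∈ π.support, S ∈ Syn (A i) := by
  simp only [MixSyn, PMF.support_map, Set.forall_mem_image, Set.mem_ofPred_eq]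

theorem mixOmega_map {ι : Type*} (π : PMF ι) (A : ι → Proc) (S : Sched) :
    mixOmega (π.map A) S = ⨆ n, expect π fun i => omegaWithin n (A i, S) := by
  simp only [mixOmega, expect_map]

theorem matches_resAll_congr {as bs : List Chan} (h : ∀ a, a ∈ as ↔ a ∈ bs) (P : Proc) :
    Matches (PMF.pure (P.resAll as)) (PMF.pure (P.resAll bs)) := by
  refine fun S hS => ⟨S, mem_mixSyn_pure.2 (syn_resAll_subset h P (mem_mixSyn_pure.1 hS)), ?_⟩
  simp only [mixOmega_pure, omegaWithin_resAll_congr h]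

/-! ### Exchanging the label of the process in the hole -/

open Classical in
/-- Exchange of two labels in a guard. -/
noncomputable def Guard.swap (a b : Label) : Guard → Guard
  | .one l => .one (Equiv.swap a b l)
  | .two l m => .two (Equiv.swap a b l) (Equiv.swap a b m)

theorem Guard.swap_self (a : Label) (g : Guard) : g.swap a a = g := by
  cases g <;> simp [Guard.swap]

theorem Guard.swap_swap (a b : Label) (g : Guard) : (g.swap a b).swap b a = g := by
  classical
  cases g <;> simp [Guard.swap, Equiv.swap_comm b a]

theorem Guard.swap_one_left (a b : Label) : Guard.swap a b (.one a) = .one b := by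
  simp [Guard.swap]

theorem Guard.swap_of_not_mem {a b : Label} {g : Guard} (ha : a ∉ g.labels) (hb : b ∉ g.labels) :
    g.swap a b = g := by
  classical
  cases g <;> simp only [Guard.labels, List.mem_cons, List.not_mem_nil, or_false, not_or] at ha hb
  · simp [Guard.swap, Equiv.swap_apply_of_ne_of_ne (Ne.symm ha) (Ne.symm hb)]
  · simp [Guard.swap, Equiv.swap_apply_of_ne_of_ne (Ne.symm ha.1) (Ne.symm hb.1),
      Equiv.swap_apply_of_ne_of_ne (Ne.symm ha.2) (Ne.symm hb.2)]

open Classical in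
/-- The scheduler that exchanges `a` and `b` in the guards until it passes a guard `σ(a)`. -/
noncomputable def swapUntil (a b : Label) : Sched → Sched :=
  Sched.unfold fun S => S.leaves.map fun y =>
    (y.1.swap a b, if y.1 = .one a then .inr y.2 else .inl y.2)

open Classical in
theorem leaves_swapUntil (a b : Label) (S : Sched) :
    (swapUntil a b S).leaves = S.leaves.map fun y =>
      (y.1.swap a b, if y.1 = .one a then y.2 else swapUntil a b y.2) := by
  rw [swapUntil, leaves_unfold, List.map_map]
  refine List.map_congr_left fun y _ => ?_
  simp only [Function.comp_apply, Prod.map_apply, id]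
  split_ifs <;> rfl

section Enabled

variable {F : Proc → Proc} {X Y : Proc} {a b : Label} {χ χ' : PMF Proc}

theorem CtxStep.not_mem_guard {g : Guard} {α : Act} {ν : PMF (Proc → Proc)}
    (h : CtxStep F g α ν) (ha : a ∉ (F .nil).labels) : a ∉ g.labels :=
  fun h' => ha (h.guard_subset h')

theorem HoleCtx.enabled_swap (hF : HoleCtx F) (hX : X.SilentTo a χ) (hY : Y.SilentTo b χ')
    (ha : a ∉ (F .nil).labels) (hb : b ∉ (F .nil).labels) {g : Guard} (h : (F X).Enabled g) :
    (F Y).Enabled (g.swap a b) := by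
  obtain ⟨α, μ, hs⟩ := h
  cases hF.fillStep_of_step hX hs with
  | ctx h =>
    rw [Guard.swap_of_not_mem (h.not_mem_guard ha) (h.not_mem_guard hb)]
    exact ⟨α, _, h.step Y⟩
  | hole h =>
    rw [Guard.swap_one_left]
    exact ⟨.tau, _, h Y b _ hY.step⟩

theorem HoleCtx.enabled_swap_iff (hF : HoleCtx F) (hX : X.SilentTo a χ) (hY : Y.SilentTo b χ')
    (ha : a ∉ (F .nil).labels) (hb : b ∉ (F .nil).labels) (g : Guard) :
    (F Y).Enabled (g.swap a b) ↔ (F X).Enabled g := by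
  refine ⟨fun h => ?_, hF.enabled_swap hX hY ha hb⟩
  have := hF.enabled_swap hY hX hb ha h
  rwa [Guard.swap_swap] at this

theorem HoleCtx.enabled_eq (hF : HoleCtx F) (hX : X.SilentTo a χ) (hY : Y.SilentTo a χ')
    (ha : a ∉ (F .nil).labels) : (F X).Enabled = (F Y).Enabled := by
  funext g
  rw [← hF.enabled_swap_iff hX hY ha ha g, Guard.swap_self]

open Classical in
theorem HoleCtx.firstEnabled_swapUntil (hF : HoleCtx F) (hX : X.SilentTo a χ)
    (hY : Y.SilentTo b χ') (ha : a ∉ (F .nil).labels) (hb : b ∉ (F .nil).labels) (S : Sched) :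
    (F Y).firstEnabled (swapUntil a b S).leaves = ((F X).firstEnabled S.leaves).map fun y =>
      (y.1.swap a b, if y.1 = .one a then y.2 else swapUntil a b y.2) := by
  rw [leaves_swapUntil, Proc.firstEnabled, Proc.firstEnabled, List.find?_map]
  congr 2
  funext y
  simp [hF.enabled_swap_iff hX hY ha hb]

end Enabled

section Family

variable {ι κ : Type*} {F : Proc → Proc} {X : ι → Proc} {Y : κ → Proc} {a b : Label}
  {χ : ι → PMF Proc} {χ' : κ → PMF Proc}

/-- The processes `X i` can be put into the context `F` without a clash of labels. -/
structure Admits (F : Proc → Proc) (X : ι → Proc) : Prop where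
  holeCtx : HoleCtx F
  disjLabels : ∀ i, DisjLabels (F .nil).labels (X i).labels

theorem Admits.not_mem [Nonempty ι] (h : Admits F X) (hX : ∀ i, (X i).SilentTo a (χ i)) :
    a ∉ (F .nil).labels :=
  (h.disjLabels (Classical.arbitrary ι)).symm.not_mem (hX _).mem_labels

theorem Admits.stepDet (h : Admits F X) (hX : ∀ i, (X i).SilentTo a (χ i)) (i : ι) :
    StepDet (F (X i)) :=
  h.holeCtx.stepDet (hX i).stepDet (h.disjLabels i)

theorem Admits.of_ctxStep {g : Guard} {α : Act} {ν : PMF (Proc → Proc)} {G : Proc → Proc}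
    (h : Admits F X) (hs : CtxStep F g α ν) (hG : G ∈ ν.support) : Admits G X :=
  ⟨hs.holeCtx G hG, fun i => (h.disjLabels i).of_covers (hs.covers hG) (.refl _)⟩

/-- The behaviour of the scheduler `S` for the processes `F (X i)`, and simultaneously that of
`swapUntil a b S` for the processes `F (Y j)`. -/
inductive SwapStep (F : Proc → Proc) (X : ι → Proc) (Y : κ → Proc) (a b : Label) (S : Sched) :
    Prop
  | none : (∀ i, (F (X i)).firstEnabled S.leaves = none) →
      (∀ j, (F (Y j)).firstEnabled (swapUntil a b S).leaves = none) → SwapStep F X Y a b S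
  | ctx {g : Guard} {T : Sched} {α : Act} {ν : PMF (Proc → Proc)} : CtxStep F g α ν →
      (∀ i, (F (X i)).firstEnabled S.leaves = some (g, T)) →
      (∀ j, (F (Y j)).firstEnabled (swapUntil a b S).leaves = some (g, swapUntil a b T)) →
      SwapStep F X Y a b S
  | hole {T : Sched} {H : Proc → Proc} : HoleStep F H →
      (∀ i, (F (X i)).firstEnabled S.leaves = some (.one a, T)) →
      (∀ j, (F (Y j)).firstEnabled (swapUntil a b S).leaves = some (.one b, T)) →
      SwapStep F X Y a b S

theorem Admits.swapStep [Nonempty ι] [Nonempty κ] (hFX : Admits F X) (hFY : Admits F Y)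
    (hX : ∀ i, (X i).SilentTo a (χ i)) (hY : ∀ j, (Y j).SilentTo b (χ' j)) (S : Sched) :
    SwapStep F X Y a b S := by
  classical
  let i₀ : ι := Classical.arbitrary ι
  have ha := hFX.not_mem hX
  have hb := hFY.not_mem hY
  have firstEnabled_X (i : ι) := Proc.firstEnabled_congr
    (hFX.holeCtx.enabled_eq (hX i) (hX i₀) ha) S.leaves
  have firstEnabled_Y (j : κ) := hFX.holeCtx.firstEnabled_swapUntil (hX i₀) (hY j) ha hb S
  rcases hp : (F (X i₀)).firstEnabled S.leaves with _ | ⟨g, T⟩ <;>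
    simp only [hp, Option.map_none, Option.map_some] at firstEnabled_X firstEnabled_Y
  · exact .none firstEnabled_X firstEnabled_Y
  · obtain ⟨α, μ, hs⟩ := Proc.enabled_of_firstEnabled hp
    cases hFX.holeCtx.fillStep_of_step (hX i₀) hs with
    | ctx h =>
      have ne_one : g ≠ .one a := by
        rintro rfl
        exact h.not_mem_guard ha (List.mem_cons_self ..)
      rw [Guard.swap_of_not_mem (h.not_mem_guard ha) (h.not_mem_guard hb), if_neg ne_one]
        at firstEnabled_Y
      exact .ctx h firstEnabled_X firstEnabled_Y
    | hole h =>
      rw [Guard.swap_one_left, if_pos rfl] at firstEnabled_Y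
      exact .hole h firstEnabled_X firstEnabled_Y

variable {π : PMF ι} {π' : PMF κ}

theorem nonempty_of_pmf (π : PMF ι) : Nonempty ι := π.support_nonempty.to_type

theorem expect_omegaWithin_swapUntil (hFX : Admits F X) (hFY : Admits F Y)
    (hX : ∀ i, (X i).SilentTo a (χ i)) (hY : ∀ j, (Y j).SilentTo b (χ' j))
    (hπ : π.bind χ = π'.bind χ') (S : Sched) (n : ℕ) :
    (expect π fun i => omegaWithin n (F (X i), S)) =
      expect π' fun j => omegaWithin n (F (Y j), swapUntil a b S) := by
  induction n generalizing F S with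
  | zero => simp only [omegaWithin, expect_const]
  | succ n ih =>
    have := nonempty_of_pmf π
    have := nonempty_of_pmf π'
    cases hFX.swapStep hFY hX hY S with
    | none hpX hpY =>
      simp only [omegaWithin_of_firstEnabled_eq_none (hpX _),
        omegaWithin_of_firstEnabled_eq_none (hpY _), expect_const]
    | ctx h hpX hpY =>
      simp only [(hFX.stepDet hX _ _).omegaWithin_succ (hpX _) (h.step _),
        (hFY.stepDet hY _ _).omegaWithin_succ (hpY _) (h.step _)]
      split_ifs
      · simp only [expect_const]
      · simp only [expect_map]
        rw [expect_comm, expect_comm π']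
        exact expect_congr _ fun G hG => ih (hFX.of_ctxStep h hG) (hFY.of_ctxStep h hG) _
    | hole h hpX hpY =>
      simp only [(hFX.stepDet hX _ _).omegaWithin_succ (hpX _) (h _ _ _ (hX _).step),
        (hFY.stepDet hY _ _).omegaWithin_succ (hpY _) (h _ _ _ (hY _).step),
        reduceCtorEq, if_false, expect_map]
      rw [← expect_bind, ← expect_bind, hπ]

theorem swapUntil_mem_mixSyn (hFX : Admits F X) (hFY : Admits F Y)
    (hX : ∀ i, (X i).SilentTo a (χ i)) (hY : ∀ j, (Y j).SilentTo b (χ' j))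
    (hπ : π.bind χ = π'.bind χ') {S : Sched} (hS : S ∈ MixSyn (π.map fun i => F (X i))) :
    swapUntil a b S ∈ MixSyn (π'.map fun j => F (Y j)) := by
  have := nonempty_of_pmf π
  have := nonempty_of_pmf π'
  refine mem_mixSyn_map.2 fun j hj => mem_syn_of_uniqueStep (fun P U => ∃ F S, Admits F X ∧
    Admits F Y ∧ (∀ i ∈ π.support, S ∈ Syn (F (X i))) ∧ P = F (Y j) ∧ U = swapUntil a b S) ?_
    ⟨F, S, hFX, hFY, mem_mixSyn_map.1 hS, rfl, rfl⟩
  rintro _ _ ⟨F, S, hFX, hFY, hS, rfl, rfl⟩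
  cases hFX.swapStep hFY hX hY S with
  | none hpX hpY =>
    obtain ⟨i, hi⟩ := π.support_nonempty
    have not_enabled := (firstEnabled_ne_none_or_of_mem_syn (hS i hi)).resolve_left (· (hpX i))
    exact .inr (.inl fun g hg => not_enabled _
      (hFX.holeCtx.enabled_swap (hY j) (hX i) (hFY.not_mem hY) (hFX.not_mem hX) hg))
  | ctx h hpX hpY =>
    refine .inr (.inr ⟨_, _, _, _, hpY j, hFY.stepDet hY j _, h.step _, ?_⟩)
    simp only [PMF.support_map, Set.forall_mem_image]
    refine fun G hG => .inl ⟨G, _, hFX.of_ctxStep h hG, hFY.of_ctxStep h hG, fun i hi => ?_,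
      rfl, rfl⟩
    exact mem_syn_of_step (hS i hi) (hpX i) (h.step _)
      ((PMF.mem_support_map_iff _ _ _).2 ⟨G, hG, rfl⟩)
  | hole h hpX hpY =>
    refine .inr (.inr ⟨_, _, _, _, hpY j, hFY.stepDet hY j _, h _ _ _ (hY j).step, ?_⟩)
    simp only [PMF.support_map, Set.forall_mem_image]
    intro R hR
    have R_mem : R ∈ (π.bind χ).support := by
      rw [hπ]
      exact (PMF.mem_support_bind_iff _ _ _).2 ⟨j, hj, hR⟩
    obtain ⟨i, hi, hR'⟩ := (PMF.mem_support_bind_iff _ _ _).1 R_mem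
    exact .inr (mem_syn_of_step (hS i hi) (hpX i) (h _ _ _ (hX i).step)
      ((PMF.mem_support_map_iff _ _ _).2 ⟨R, hR', rfl⟩))

theorem matches_of_bind_eq (hFX : Admits F X) (hFY : Admits F Y)
    (hX : ∀ i, (X i).SilentTo a (χ i)) (hY : ∀ j, (Y j).SilentTo b (χ' j))
    (hπ : π.bind χ = π'.bind χ') :
    Matches (π.map fun i => F (X i)) (π'.map fun j => F (Y j)) := by
  refine fun S hS => ⟨_, swapUntil_mem_mixSyn hFX hFY hX hY hπ hS, ?_⟩
  simp only [mixOmega_map, expect_omegaWithin_swapUntil hFX hFY hX hY hπ]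

end Family

/-! ### Anticipating a probabilistic choice -/

/-- The parallel composition of `Y` and `R`, restricted on the channels in `as`. -/
def beside (as : List Chan) (R Y : Proc) : Proc := (Proc.par Y R).resAll as

section Beside

variable {as : List Chan} {R Y : Proc} {g : Guard} {α : Act} {μ : PMF Proc} {ls : List Label}

theorem not_step_of_covers (hg : Covers ls g.labels) (hY : DisjLabels ls Y.labels) :
    ¬ Step Y g α μ := by
  intro h
  have disj := hY.of_covers hg (.refl _)
  cases g <;> exact disj.not_mem (List.mem_cons_self ..) (h.guard_subset (List.mem_cons_self ..))

theorem step_beside_iff (hg : Covers ls g.labels) (hY : DisjLabels ls Y.labels) :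
    Step (beside as R Y) g α μ ↔ (∀ a ∈ as, α ≠ .inp a ∧ α ≠ .out a) ∧
      ∃ ν, Step R g α ν ∧ μ = ν.map fun R' => beside as R' Y := by
  have map_beside (ν : PMF Proc) : (ν.map fun R' => Proc.par Y R').map (Proc.resAll as) =
      ν.map fun R' => beside as R' Y := PMF.map_comp ..
  rw [beside, step_resAll_iff]
  refine and_congr_right fun _ => ⟨?_, ?_⟩
  · rintro ⟨μ', hs, rfl⟩
    cases hs with
    | par1 h => exact absurd h (not_step_of_covers hg hY)
    | par2 h => exact ⟨_, h, map_beside _⟩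
    | com h =>
      have covers_left : Covers ls [_] := fun M hM => hg M (List.mem_cons.2 (.inl
        (List.mem_singleton.1 hM)))
      exact absurd h (not_step_of_covers covers_left hY)
  · rintro ⟨ν, hs, rfl⟩
    exact ⟨_, .par2 hs, (map_beside ν).symm⟩

theorem Deterministic.uniqueStep_beside (hR : Deterministic R) (hg : Covers ls g.labels)
    (hY : DisjLabels ls Y.labels) : UniqueStep (beside as R Y) g := by
  intro α β μ ν hμ hν
  obtain ⟨-, μ', hμ', rfl⟩ := (step_beside_iff hg hY).1 hμ
  obtain ⟨-, ν', hν', rfl⟩ := (step_beside_iff hg hY).1 hν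
  obtain ⟨rfl, rfl⟩ := hR.stepDet g _ _ _ _ hμ' hν'
  exact ⟨rfl, rfl⟩

theorem enabled_beside_iff {Z : Proc} (hg : Covers ls g.labels) (hY : DisjLabels ls Y.labels)
    (hZ : DisjLabels ls Z.labels) : (beside as R Y).Enabled g ↔ (beside as R Z).Enabled g := by
  have enabled_iff {W : Proc} (hW : DisjLabels ls W.labels) : (beside as R W).Enabled g ↔
      ∃ α, (∀ a ∈ as, α ≠ .inp a ∧ α ≠ .out a) ∧ ∃ ν, Step R g α ν := by
    simp only [Proc.Enabled, step_beside_iff hg hW, exists_and_left]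
    refine exists_congr fun α => and_congr_right fun _ => ?_
    exact ⟨fun ⟨_, ν, hs, _⟩ => ⟨ν, hs⟩, fun ⟨ν, hs⟩ => ⟨_, ν, hs, rfl⟩⟩
  rw [enabled_iff hY, enabled_iff hZ]

end Beside

open Classical in
/-- The first leaves of `anticipate l ls` for a scheduler with the leaves in the list: up to a
leaf with the guard `σ(l)`, those with guards whose labels extend labels in `ls`; then the leaves
of the continuation after `σ(l)`. -/
noncomputable def anticipateLeaves (l : Label) (ls : List Label) :
    List (Guard × Sched) → List (Guard × (Sched ⊕ Sched))
  | [] => []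
  | y :: L =>
    if y.1 = .one l then y.2.leaves.map (Prod.map id .inr)
    else if Covers ls y.1.labels then (y.1, .inl y.2) :: anticipateLeaves l ls L
    else anticipateLeaves l ls L

/-- The scheduler that acts on a process whose choice at `l` is already resolved as the given one
acts before the resolution: it skips the guard `σ(l)`, and before that it only uses guards with
labels that extend those in `ls`. -/
noncomputable def anticipate (l : Label) (ls : List Label) : Sched → Sched :=
  Sched.unfold fun S => anticipateLeaves l ls S.leaves

open Classical in
theorem firstEnabled_anticipate {A B : Proc} {l : Label} {ls : List Label}
    (hl : A.Enabled (.one l)) (hA : ∀ g, A.Enabled g → g = .one l ∨ Covers ls g.labels)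
    (hAB : ∀ g, Covers ls g.labels → (A.Enabled g ↔ B.Enabled g)) (S : Sched) :
    B.firstEnabled (anticipate l ls S).leaves = (A.firstEnabled S.leaves).bind fun y =>
      if y.1 = .one l then B.firstEnabled y.2.leaves
      else some (y.1, anticipate l ls y.2) := by
  rw [anticipate, leaves_unfold, ← anticipate]
  induction S.leaves with
  | nil => rfl
  | cons y L ih =>
    by_cases hy : y.1 = .one l
    · rw [Proc.firstEnabled_cons_of_enabled (hy ▸ hl), anticipateLeaves, if_pos hy, List.map_map,
        Prod.map_comp_map, Option.bind_some, if_pos hy]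
      simp
    by_cases hc : Covers ls y.1.labels
    · rw [anticipateLeaves, if_neg hy, if_pos hc, List.map_cons]
      by_cases he : A.Enabled y.1
      · rw [Proc.firstEnabled_cons_of_enabled he, Option.bind_some, if_neg hy]
        exact Proc.firstEnabled_cons_of_enabled ((hAB _ hc).1 he)
      · rw [Proc.firstEnabled_cons_of_not_enabled he, ← ih]
        exact Proc.firstEnabled_cons_of_not_enabled (mt (hAB _ hc).2 he)
    · have not_enabled : ¬ A.Enabled y.1 := fun he => (hA _ he).elim hy hc
      rw [anticipateLeaves, if_neg hy, if_neg hc, Proc.firstEnabled_cons_of_not_enabled not_enabled,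
        ih]

section Anticipate

variable {as : List Chan} {R : Proc} {ls : List Label} {n : ℕ} {l : Label} {w : PMF (Fin n)}
  {B : Fin n → Proc}

theorem step_beside_psum_iff (hR : Covers ls R.labels)
    (hB : DisjLabels ls (Proc.psum l w B).labels) {α : Act} {μ : PMF Proc} :
    Step (beside as R (.psum l w B)) (.one l) α μ ↔
      α = .tau ∧ μ = w.map fun i => beside as R (B i) := by
  have map_beside : ((w.map B).map fun Y => Proc.par Y R).map (Proc.resAll as) =
      w.map fun i => beside as R (B i) := by
    rw [PMF.map_comp, PMF.map_comp]
    rfl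
  rw [beside, step_resAll_iff]
  constructor
  · rintro ⟨-, μ', hs, rfl⟩
    cases hs with
    | par1 h =>
      cases h
      exact ⟨rfl, map_beside⟩
    | par2 h =>
      exact absurd (h.guard_subset (List.mem_cons_self ..))
        ((hB.of_covers hR (.refl _)).symm.not_mem (List.mem_cons_self ..))
  · rintro ⟨rfl, rfl⟩
    exact ⟨by simp, _, .par1 (.prob l w B), map_beside.symm⟩

theorem eq_or_covers_of_enabled_beside_psum (hR : Covers ls R.labels) {g : Guard}
    (h : (beside as R (.psum l w B)).Enabled g) : g = .one l ∨ Covers ls g.labels := by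
  obtain ⟨α, μ, hs⟩ := h
  obtain ⟨-, μ', hs', -⟩ := step_resAll_iff.1 hs
  cases hs' with
  | par1 h =>
    cases h
    exact .inl rfl
  | par2 h => exact .inr (hR.trans (.of_subset h.guard_subset))
  | com h _ hc => exact absurd ((silentTo_psum l w B _ _ _).1 h).2.1 hc.ne_tau.1

/-- The behaviour of the scheduler `S` for the choice `l : ∑ i, w i (B i)` beside `R`, and
simultaneously that of `anticipate l ls S` for the resolved processes `B i` beside `R`. -/
inductive AnticipateStep (as : List Chan) (ls : List Label) (l : Label) (w : PMF (Fin n))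
    (B : Fin n → Proc) (R : Proc) (S : Sched) : Prop
  | none : (beside as R (.psum l w B)).firstEnabled S.leaves = none →
      (∀ i, (beside as R (B i)).firstEnabled (anticipate l ls S).leaves = none) →
      AnticipateStep as ls l w B R S
  | choice {T : Sched} : (beside as R (.psum l w B)).firstEnabled S.leaves = some (.one l, T) →
      (∀ i, (beside as R (B i)).firstEnabled (anticipate l ls S).leaves =
        (beside as R (B i)).firstEnabled T.leaves) →
      AnticipateStep as ls l w B R S
  | test {g : Guard} {T : Sched} {α : Act} {ν : PMF Proc} : Covers ls g.labels → Step R g α ν →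
      (∀ Y, DisjLabels ls Y.labels →
        Step (beside as R Y) g α (ν.map fun R' => beside as R' Y)) →
      (beside as R (.psum l w B)).firstEnabled S.leaves = some (g, T) →
      (∀ i, (beside as R (B i)).firstEnabled (anticipate l ls S).leaves =
        some (g, anticipate l ls T)) →
      AnticipateStep as ls l w B R S

theorem disjLabels_of_psum (hB : DisjLabels ls (Proc.psum l w B).labels) (i : Fin n) :
    DisjLabels ls (B i).labels :=
  hB.mono (List.Subset.refl _) (labels_sublist_psum l w B i).subset

theorem anticipateStep (hR : Covers ls R.labels) (hB : DisjLabels ls (Proc.psum l w B).labels)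
    (S : Sched) : AnticipateStep as ls l w B R S := by
  classical
  have firstEnabled_B (i : Fin n) := firstEnabled_anticipate
    ⟨_, _, (step_beside_psum_iff (as := as) hR hB).2 ⟨rfl, rfl⟩⟩
    (fun g => eq_or_covers_of_enabled_beside_psum hR)
    (fun g hg => enabled_beside_iff hg hB (disjLabels_of_psum hB i)) S
  rcases hp : (beside as R (.psum l w B)).firstEnabled S.leaves with _ | ⟨g, T⟩ <;>
    simp only [hp, Option.bind_none, Option.bind_some] at firstEnabled_B
  · exact .none hp firstEnabled_B
  by_cases hg : g = .one l
  · subst hg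
    simp only [if_true] at firstEnabled_B
    exact .choice hp firstEnabled_B
  · simp only [hg, if_false] at firstEnabled_B
    have enabled := Proc.enabled_of_firstEnabled hp
    have covers := (eq_or_covers_of_enabled_beside_psum hR enabled).resolve_left hg
    obtain ⟨α, μ, hs⟩ := enabled
    obtain ⟨has, ν, hν, -⟩ := (step_beside_iff covers hB).1 hs
    exact .test covers hν (fun Y hY => (step_beside_iff covers hY).2 ⟨has, ν, hν, rfl⟩) hp
      firstEnabled_B

theorem uniqueStep_beside_psum (hR : Covers ls R.labels)
    (hB : DisjLabels ls (Proc.psum l w B).labels) :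
    UniqueStep (beside as R (.psum l w B)) (.one l) := by
  intro α β μ ν hμ hν
  obtain ⟨rfl, rfl⟩ := (step_beside_psum_iff hR hB).1 hμ
  obtain ⟨rfl, rfl⟩ := (step_beside_psum_iff hR hB).1 hν
  exact ⟨rfl, rfl⟩

theorem omegaWithin_beside_psum_succ (hR : Covers ls R.labels)
    (hB : DisjLabels ls (Proc.psum l w B).labels) {S T : Sched}
    (hp : (beside as R (.psum l w B)).firstEnabled S.leaves = some (.one l, T)) (k : ℕ) :
    omegaWithin (k + 1) (beside as R (.psum l w B), S) =
      expect w fun i => omegaWithin k (beside as R (B i), T) := by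
  rw [(uniqueStep_beside_psum hR hB).omegaWithin_succ hp
    ((step_beside_psum_iff hR hB).2 ⟨rfl, rfl⟩), if_neg (by simp), expect_map]

theorem expect_omegaWithin_anticipate_mem_Icc (hdet : Deterministic R) (hR : Covers ls R.labels)
    (hB : DisjLabels ls (Proc.psum l w B).labels) (S : Sched) (k : ℕ) :
    (expect w fun i => omegaWithin k (beside as R (B i), anticipate l ls S)) ∈
      Set.Icc (omegaWithin k (beside as R (.psum l w B), S))
        (omegaWithin (k + 1) (beside as R (.psum l w B), S)) := by
  have hBi := disjLabels_of_psum hB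
  induction k generalizing R S with
  | zero => simp [omegaWithin, expect_const]
  | succ k ih =>
    cases anticipateStep (as := as) hR hB S with
    | none hp hpB =>
      simp only [omegaWithin_of_firstEnabled_eq_none hp,
        omegaWithin_of_firstEnabled_eq_none (hpB _), expect_const, Set.Icc_self,
        Set.mem_singleton_iff]
    | choice hp hpB =>
      simp only [omegaWithin_beside_psum_succ hR hB hp, omegaWithin_congr (hpB _)]
      exact ⟨expect_mono _ fun i _ => omegaWithin_mono _ k.le_succ, le_rfl⟩
    | test hg hs hstep hp hpB =>
      simp only [(hdet.uniqueStep_beside hg hB).omegaWithin_succ hp (hstep _ hB),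
        (hdet.uniqueStep_beside hg (hBi _)).omegaWithin_succ (hpB _) (hstep _ (hBi _))]
      split_ifs
      · simp only [expect_const, Set.Icc_self, Set.mem_singleton_iff]
      · simp only [expect_map]
        rw [expect_comm]
        have ih' (R') (hR' : R' ∈ _) := ih (hdet.of_step hs hR') (hR.trans (hs.covers R' hR'))
        exact ⟨expect_mono _ fun R' hR' => (ih' R' hR' _).1,
          expect_mono _ fun R' hR' => (ih' R' hR' _).2⟩

theorem anticipate_mem_syn (hdet : Deterministic R) (hR : Covers ls R.labels)
    (hB : DisjLabels ls (Proc.psum l w B).labels) {S : Sched}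
    (hS : S ∈ Syn (beside as R (.psum l w B))) {i : Fin n} (hi : i ∈ w.support) :
    anticipate l ls S ∈ Syn (beside as R (B i)) := by
  refine mem_syn_of_uniqueStep (fun P U => ∃ R S, Deterministic R ∧ Covers ls R.labels ∧
    S ∈ Syn (beside as R (.psum l w B)) ∧ P = beside as R (B i) ∧ U = anticipate l ls S) ?_
    ⟨R, S, hdet, hR, hS, rfl, rfl⟩
  rintro _ _ ⟨R, S, hdet, hR, hS, rfl, rfl⟩
  have choice_step := (step_beside_psum_iff (as := as) hR hB).2 ⟨rfl, rfl⟩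
  cases anticipateStep (as := as) hR hB S with
  | none hp =>
    exact ((firstEnabled_ne_none_or_of_mem_syn hS).resolve_left (· hp) _ ⟨_, _, choice_step⟩).elim
  | choice hp hpB =>
    exact .inl (mem_syn_congr (hpB i).symm (mem_syn_of_step hS hp choice_step
      ((PMF.mem_support_map_iff _ _ _).2 ⟨i, hi, rfl⟩)))
  | test hg hs hstep hp hpB =>
    have hBi := disjLabels_of_psum hB i
    refine .inr (.inr ⟨_, _, _, _, hpB i, hdet.uniqueStep_beside hg hBi, hstep _ hBi, ?_⟩)
    simp only [PMF.support_map, Set.forall_mem_image]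
    exact fun R' hR' => .inl ⟨R', _, hdet.of_step hs hR', hR.trans (hs.covers R' hR'),
      mem_syn_of_step hS hp (hstep _ hB) ((PMF.mem_support_map_iff _ _ _).2 ⟨R', hR', rfl⟩),
      rfl, rfl⟩

theorem matches_anticipate (hdet : Deterministic R)
    (hB : DisjLabels R.labels (Proc.psum l w B).labels) :
    Matches (PMF.pure (beside as R (.psum l w B))) (w.map fun i => beside as R (B i)) := by
  refine fun S hS => ⟨anticipate l R.labels S, mem_mixSyn_map.2 fun i =>
    anticipate_mem_syn hdet (.refl _) hB (mem_mixSyn_pure.1 hS), ?_⟩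
  have mem_Icc := expect_omegaWithin_anticipate_mem_Icc (as := as) hdet (.refl _) hB S
  rw [mixOmega_pure, mixOmega_map]
  exact le_antisymm (iSup_mono fun k => (mem_Icc k).1)
    (iSup_le fun k => (mem_Icc k).2.trans (le_iSup (fun k => omegaWithin k (_, S)) (k + 1)))

theorem matches_resolve (hB : DisjLabels R.labels (Proc.psum l w B).labels) :
    Matches (w.map fun i => beside as R (B i)) (PMF.pure (beside as R (.psum l w B))) := by
  intro T hT
  have choice_step := (step_beside_psum_iff (as := as) (.refl _) hB).2 ⟨rfl, rfl⟩
  have hp := Proc.Enabled.firstEnabled_guard ⟨_, _, choice_step⟩ T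
  refine ⟨Sched.guard (.one l) T, mem_mixSyn_pure.2 ?_, ?_⟩
  · refine mem_syn_of_uniqueStep (fun P U => P = beside as R (.psum l w B) ∧
      U = Sched.guard (.one l) T) ?_ ⟨rfl, rfl⟩
    rintro _ _ ⟨rfl, rfl⟩
    exact .inr (.inr ⟨_, _, _, _, hp, uniqueStep_beside_psum (.refl _) hB, choice_step,
      fun A hA => .inr (hT A hA)⟩)
  · rw [mixOmega_pure, mixOmega_map, ← (omegaWithin_mono _).iSup_nat_add 1]
    simp only [omegaWithin_beside_psum_succ (.refl _) hB hp]

end Anticipate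

/-! ### Testing -/

theorem pOmega_eq_mixOmega (P : Proc) (S : Sched) (O : Proc) :
    pOmega P S O = mixOmega (PMF.pure (Proc.par P O).hide) S := by
  rw [pOmega_eq_iSup_omegaWithin, mixOmega_pure]

theorem mayLE_and_mustLE_of_matches {P Q : Proc} (h : ∀ O, IsTest {P, Q} O →
    Matches (PMF.pure (Proc.par P O).hide) (PMF.pure (Proc.par Q O).hide)) :
    MayLE P Q ∧ MustLE Q P := by
  have exists_eq {O : Proc} (hO : IsTest {P, Q} O) {S : Sched}
      (hS : S ∈ Syn (Proc.par P O).hide) :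
      ∃ T ∈ Syn (Proc.par Q O).hide, pOmega P S O = pOmega Q T O := by
    obtain ⟨T, hT, hST⟩ := h O hO S (mem_mixSyn_pure.2 hS)
    exact ⟨T, mem_mixSyn_pure.1 hT, by rw [pOmega_eq_mixOmega, hST, pOmega_eq_mixOmega]⟩
  refine ⟨fun O hO S hS => ?_, fun O hO S hS => ?_⟩
  · exact (exists_eq hO hS).imp fun T hT => ⟨hT.1, hT.2.le⟩
  · rw [Set.pair_comm] at hO
    exact (exists_eq hO hS).imp fun T hT => ⟨hT.1, hT.2.ge⟩

theorem mayEquiv_and_mustEquiv_of_matches {P Q : Proc} (h : ∀ O, IsTest {P, Q} O →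
    AntisymmRel Matches (PMF.pure (Proc.par P O).hide) (PMF.pure (Proc.par Q O).hide)) :
    MayEquiv P Q ∧ MustEquiv P Q := by
  obtain ⟨mayPQ, mustQP⟩ := mayLE_and_mustLE_of_matches fun O hO => (h O hO).1
  obtain ⟨mayQP, mustPQ⟩ := mayLE_and_mustLE_of_matches (P := Q) (Q := P) fun O hO =>
    (h O (by rwa [Set.pair_comm])).2
  exact ⟨⟨mayPQ, mayQP⟩, ⟨mustPQ, mustQP⟩⟩

/-- The channels of a process, on which `Proc.hide` restricts it. -/
def Proc.chans (P : Proc) : List Chan := P.actions.filterMap Act.chan?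

theorem hide_par (P O : Proc) : (Proc.par P O).hide = beside (Proc.par P O).chans O P := rfl

theorem Proc.mem_chans_par_congr {P Q : Proc}
    (h : ∀ α, α ≠ .tau → (α ∈ P.actions ↔ α ∈ Q.actions)) (O : Proc) (a : Chan) :
    a ∈ (Proc.par P O).chans ↔ a ∈ (Proc.par Q O).chans := by
  simp only [Proc.chans, Proc.actions, List.mem_filterMap, List.mem_append]
  refine exists_congr fun α => and_congr_left fun hα => ?_
  rw [h α]
  rintro rfl
  cases hα

theorem matches_hide_par {P Q O : Proc}
    (hact : ∀ α, α ≠ .tau → (α ∈ P.actions ↔ α ∈ Q.actions))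
    (h : ∀ as, AntisymmRel Matches (PMF.pure (beside as O P)) (PMF.pure (beside as O Q))) :
    AntisymmRel Matches (PMF.pure (Proc.par P O).hide) (PMF.pure (Proc.par Q O).hide) := by
  have chans := Proc.mem_chans_par_congr hact O
  rw [hide_par, hide_par]
  exact (h _).trans
    ⟨matches_resAll_congr chans _, matches_resAll_congr (fun a => (chans a).symm) _⟩

theorem exists_dite_eq_iff {ι β : Type*} [DecidableEq ι] {i : ι} {y : β}
    {f : {j // j ≠ i} → β} (p : β → Prop) :
    (∃ j, p (if h : j = i then y else f ⟨j, h⟩)) ↔ p y ∨ ∃ j, p (f j) := by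
  constructor
  · rintro ⟨j, hj⟩
    by_cases h : j = i
    · exact .inl (by simpa only [h, dite_true] using hj)
    · exact .inr ⟨⟨j, h⟩, by simpa only [h, dite_false] using hj⟩
  · rintro (hy | ⟨⟨j, h⟩, hj⟩)
    · exact ⟨i, by simpa only [dite_true] using hy⟩
    · exact ⟨j, by simpa only [h, dite_false] using hj⟩

theorem Ctx.mem_labels_fill (C : Ctx) (X : Proc) (M : Label) :
    M ∈ (C.fill X).labels ↔ M ∈ C.labels ∨ M ∈ X.labels := by
  rw [Ctx.labels]
  induction C with
  | hole => simp [Ctx.fill, Proc.labels]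
  | pre l α C ih | res a C ih | bang C ih => simp [Ctx.fill, Proc.labels, ih, or_assoc]
  | parL C R ih | parR R C ih | sumL C R ih | sumR R C ih =>
    simp only [Ctx.fill, Proc.labels, List.mem_append, ih]
    tauto
  | psum l w i C P ih =>
    simp only [Ctx.fill, Proc.labels, List.mem_cons, List.mem_flatten, List.mem_ofFn,
      exists_exists_eq_and, exists_dite_eq_iff fun Q : Proc => M ∈ Q.labels, ih]
    tauto

theorem Ctx.mem_actions_fill (C : Ctx) (X : Proc) (α : Act) :
    α ∈ (C.fill X).actions ↔ α ∈ (C.fill .nil).actions ∨ α ∈ X.actions := by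
  induction C with
  | hole => simp [Ctx.fill, Proc.actions]
  | pre l β C ih | res a C ih | bang C ih => simp [Ctx.fill, Proc.actions, ih, or_assoc]
  | parL C R ih | parR R C ih | sumL C R ih | sumR R C ih =>
    simp only [Ctx.fill, Proc.actions, List.mem_append, ih]
    tauto
  | psum l w i C P ih =>
    simp only [Ctx.fill, Proc.actions, List.mem_flatten, List.mem_ofFn, exists_exists_eq_and,
      exists_dite_eq_iff fun Q : Proc => α ∈ Q.actions, ih]
    tauto

section Distribution

variable {n : ℕ} {w : PMF (Fin n)} {P : Fin n → Proc} {l l₁ : Label}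

theorem mem_actions_psum_fill_pre_iff (C : Ctx) {α : Act} (hα : α ≠ .tau) :
    α ∈ (Proc.psum l w fun i => C.fill (.pre l₁ .tau (P i))).actions ↔
      α ∈ (C.fill (.psum l w P)).actions := by
  have := nonempty_of_pmf w
  simp only [Proc.actions, List.mem_flatten, List.mem_ofFn, exists_exists_eq_and,
    C.mem_actions_fill (.pre _ _ _), C.mem_actions_fill (.psum _ _ _), List.mem_cons, hα, false_or,
    exists_or, exists_const]

theorem matches_pre_psum {F : Proc → Proc} (hpre : Admits F fun i => .pre l₁ .tau (P i))
    (hpsum : Admits F fun _ : Unit => .psum l w P) :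
    AntisymmRel Matches (w.map fun i => F (.pre l₁ .tau (P i))) (PMF.pure (F (.psum l w P))) := by
  have silent_pre (i) := silentTo_pre l₁ (P i)
  have silent_psum (_ : Unit) := silentTo_psum l w P
  have bind_eq : (w.bind fun i => PMF.pure (P i)) = (PMF.pure ()).bind fun _ => w.map P := by
    rw [PMF.pure_bind]
    rfl
  rw [← PMF.pure_map (fun _ : Unit => F (.psum l w P)) ()]
  exact ⟨matches_of_bind_eq hpre hpsum silent_pre silent_psum bind_eq,
    matches_of_bind_eq hpsum hpre silent_psum silent_pre bind_eq.symm⟩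

theorem Ctx.admits_beside {ι : Type*} {X : ι → Proc} {C : Ctx} {O : Proc} (as : List Chan)
    (hb : C.BangFree) (hl : Linear C.labels) (hO : Deterministic O)
    (hCX : ∀ i, DisjLabels C.labels (X i).labels) (hOC : DisjLabels O.labels C.labels)
    (hOX : ∀ i, DisjLabels O.labels (X i).labels) :
    Admits (fun Y => beside as O (C.fill Y)) X where
  holeCtx := ((Ctx.holeCtx_fill hb hl).parL hO hOC.symm).resAll as
  disjLabels i := by
    rw [beside, labels_resAll]
    exact fun L hL => (List.mem_append.1 hL).elim (hCX i L) (hOX i L)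

theorem matches_beside_psum_fill_pre (as : List Chan) {C : Ctx} {O : Proc} (hb : C.BangFree)
    (hC : FreshLabels C.labels (insert (.psum l w P) (Set.range fun i => .pre l₁ .tau (P i))))
    (hO : Deterministic O)
    (houter : DisjLabels O.labels (Proc.psum l w fun i => C.fill (.pre l₁ .tau (P i))).labels)
    (hinner : DisjLabels O.labels (C.fill (.psum l w P)).labels) :
    AntisymmRel Matches
      (PMF.pure (beside as O (.psum l w fun i => C.fill (.pre l₁ .tau (P i)))))
      (PMF.pure (beside as O (C.fill (.psum l w P)))) := by
  have disj_ctx : DisjLabels O.labels C.labels :=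
    hinner.mono (List.Subset.refl _) fun M hM => (C.mem_labels_fill _ M).2 (.inl hM)
  have admits_pre : Admits (fun X => beside as O (C.fill X)) fun i => .pre l₁ .tau (P i) :=
    Ctx.admits_beside as hb hC.1 hO (fun i L hL => hC.2 L hL _ (.inr ⟨i, rfl⟩)) disj_ctx
      fun i => (disjLabels_of_psum houter i).mono (List.Subset.refl _)
        fun M hM => (C.mem_labels_fill _ M).2 (.inr hM)
  have admits_psum : Admits (fun X => beside as O (C.fill X)) fun _ : Unit => .psum l w P :=
    Ctx.admits_beside as hb hC.1 hO (fun _ L hL => hC.2 L hL _ (.inl rfl)) disj_ctx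
      fun _ => hinner.mono (List.Subset.refl _) fun M hM => (C.mem_labels_fill _ M).2 (.inr hM)
  have choice : AntisymmRel Matches
      (PMF.pure (beside as O (.psum l w fun i => C.fill (.pre l₁ .tau (P i)))))
      (w.map fun i => beside as O (C.fill (.pre l₁ .tau (P i)))) :=
    ⟨matches_anticipate hO houter, matches_resolve houter⟩
  exact choice.trans (matches_pre_psum admits_pre admits_psum)

theorem matches_psum_fill_pre {C : Ctx} {O : Proc} (hb : C.BangFree)
    (hC : FreshLabels C.labels (insert (.psum l w P) (Set.range fun i => .pre l₁ .tau (P i))))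
    (hO : IsTest {.psum l w fun i => C.fill (.pre l₁ .tau (P i)), C.fill (.psum l w P)} O) :
    AntisymmRel Matches
      (PMF.pure (Proc.par (.psum l w fun i => C.fill (.pre l₁ .tau (P i))) O).hide)
      (PMF.pure (Proc.par (C.fill (.psum l w P)) O).hide) :=
  matches_hide_par (fun _ => mem_actions_psum_fill_pre_iff C) fun as =>
    matches_beside_psum_fill_pre as hb hC hO.1 (fun L hL => hO.2.1.2 L hL _ (.inl rfl))
      fun L hL => hO.2.1.2 L hL _ (.inr rfl)

end Distribution

end CCS

theorem mainTheorem1_general {n : ℕ} (w : PMF (Fin n)) (P : Fin n → CCS.Proc) (C : CCS.Ctx)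
    (l l₁ : CCS.Label)
    (hC : CCS.FreshLabels C.labels
      (insert (CCS.Proc.psum l w P) (Set.range fun i => CCS.Proc.pre l₁ .tau (P i))))
    (hbang : C.BangFree) :
    CCS.MayEquiv (.psum l w fun i => C.fill (.pre l₁ .tau (P i))) (C.fill (.psum l w P)) ∧
      CCS.MustEquiv (.psum l w fun i => C.fill (.pre l₁ .tau (P i))) (C.fill (.psum l w P)) :=
  CCS.mayEquiv_and_mustEquiv_of_matches fun _ => CCS.matches_psum_fill_pre hbang hC

theorem mainTheorem1 (P Q : CCS.Proc) (C : CCS.Ctx) (l l₁ : CCS.Label)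
    (p : ℝ≥0) (hp : p ≤ 1)
    (hP : CCS.Deterministic P) (hQ : CCS.Deterministic Q)
    (hC : CCS.FreshLabels C.labels
      {CCS.Proc.pre l₁ .tau P, CCS.Proc.pre l₁ .tau Q, CCS.Proc.bsum l p hp P Q})
    (hbang : C.BangFree) :
    CCS.MayEquiv
        (CCS.Proc.bsum l p hp (C.fill (.pre l₁ .tau P)) (C.fill (.pre l₁ .tau Q)))
        (C.fill (CCS.Proc.bsum l p hp P Q)) ∧
      CCS.MustEquiv
        (CCS.Proc.bsum l p hp (C.fill (.pre l₁ .tau P)) (C.fill (.pre l₁ .tau Q)))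
        (C.fill (CCS.Proc.bsum l p hp P Q)) := by
  have fill_comm : ![C.fill (.pre l₁ .tau P), C.fill (.pre l₁ .tau Q)] =
      fun i => C.fill (.pre l₁ .tau (![P, Q] i)) := by
    funext i
    fin_cases i <;> rfl
  rw [CCS.Proc.bsum, fill_comm]
  refine mainTheorem1_general _ _ C l l₁ ⟨hC.1, fun L hL R hR => hC.2 L hL R ?_⟩ hbang
  rcases hR with rfl | ⟨i, rfl⟩
  · exact .inr (.inr rfl)
  · fin_cases i
    · exact .inl rfl
    · exact .inr (.inl rfl)
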